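/- **Pointwise product of $N=2$ irreducible $\mathrm{SU}(2)$ quasicharacters.** For a spin $j\in\{0,\tfrac12,1,\dots\}$ let $(H_j,D_j)$ be the standard unitary irreducible representation of $\mathrm{SU}(2)$ of spin $j$, let $[j]=2j+1$, and let $\langle j_1,j_2\rangle=\{|j_1-j_2|,|j_1-j_2|+1,\dots,j_1+j_2\}$. For $k\in\langle j_1,j_2\rangle$ let $\mathbb P^k_{j_1j_2}$ be the orthogonal projector of $H_{j_1}\otimes H_{j_2}$ onto its spin-$k$ subspace under $u\mapsto D_{j_1}(u)\otimes D_{j_2}(u)$, and let $$\chi^k_{j_1j_2}(u,v)=\operatorname{Tr}\big(\mathbb P^k_{j_1j_2}\,(D_{j_1}(u)\otimes D_{j_2}(v))\big),\qquad u,v\in \mathrm{SU}(2).$$ Fix spins $j_1,j_2,j_1',j_2'$ and $k\in\langle j_1,j_2\rangle$, $k'\in\langle j_1',j_2'\rangle$. Let $\mathrm{SU}(2)\times\mathrm{SU}(2)$ act on $H=H_{j_1}\otimes H_{j_2}\otimes H_{j_1'}\otimes H_{j_2'}$ by $D(u,v)=D_{j_1}(u)\otimes D_{j_2}(v)\otimes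 D_{j_1'}(u)\otimes D_{j_2'}(v)$. For $J_1\in\langle j_1,j_1'\rangle$ and $J_2\in\langle j_2,j_2'\rangle$ let $\Pi_{J_1J_2}$ be the orthogonal projector of $H$ onto the copy of $H_{J_1}\otimes H_{J_2}$ in $H$, and for $K\in\langle J_1,J_2\rangle$ let $\widehat{\mathbb P}^K_{J_1J_2}$ (the grand projector) be the orthogonal projector of $H$ onto the spin-$K$ subspace of that copy. Put $$c^{K}_{J_1J_2}=[J_1][J_2][k][k']\begin{Bmatrix} j_1&j_2&k\\ j_1'&j_2'&k'\\ J_1&J_2&K\end{Bmatrix}^2$$ with the Wigner $9j$ symbol. All sums below run over $J_1\in\langle j_1,j_1'\rangle$, $J_2\in\langle j_2,j_2'\rangle$, $K\in\langle J_1,J_2\rangle$. Then: 1. the part of $\mathbb P^k_{j_1j_2}\otimes\mathbb P^{k'}_{j_1'j_2'}$ that is block diagonal with respect to $H=\bigoplus_{J_1,J_2}\Pi_{J_1J_2}H$ is $$\sum_{J_1,J_2}\Pi_{J_1J_2}\,\big(\mathbb P^k_{j_1j_2}\otimes\mathbb P^{k'}_{j_1'j_2'}\big)\,\Pi_{J_1J_2}=\sum_{J_1,J_2,K}c^K_{J_1J_2}\,\widehat{\mathbb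 P}^K_{J_1J_2};$$ 2. for all $u,v\in\mathrm{SU}(2)$, $$\operatorname{Tr}\big((\mathbb P^k_{j_1j_2}\otimes\mathbb P^{k'}_{j_1'j_2'})\,D(u,v)\big)=\sum_{J_1,J_2,K}c^K_{J_1J_2}\operatorname{Tr}\big(\widehat{\mathbb P}^K_{J_1J_2}\,D(u,v)\big);$$ 3. for all $u,v\in\mathrm{SU}(2)$, $$\chi^k_{j_1j_2}(u,v)\,\chi^{k'}_{j_1'j_2'}(u,v)=\sum_{J_1,J_2,K}c^K_{J_1J_2}\,\chi^K_{J_1J_2}(u,v).$$ -/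

import Mathlib

open scoped TensorProduct Nat
open Polynomial (C X)

noncomputable section

namespace SpinRecoupling

/-! Throughout, a spin `j ∈ {0, 1/2, 1, ...}` is encoded by its Dynkin label `n = 2j : ℕ`, so that
`[j] = 2j + 1 = n + 1`.  The ladder vector `|j, m⟩` is encoded by the index
`p = j + m ∈ {0, ..., n}`, so that `j - m = n - p`. -/

/-- The group `SU(2)`. -/
abbrev SU2 : Type := Matrix.specialUnitaryGroup (Fin 2) ℂ

/-- The Hilbert space of the spin-`n/2` representation, with its orthonormal ladder basis. -/
abbrev SpinSpace (n : ℕ) : Type := EuclideanSpace ℂ (Fin (n + 1))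

/-- `(u₀₀ x + u₁₀)^q (u₀₁ x + u₁₁)^(n-q)`: the image of the monomial `x^q y^(n-q)` under the linear
substitution `u` of `x, y`, dehomogenised at `y = 1`. -/
def binaryForm (n : ℕ) (u : Matrix (Fin 2) (Fin 2) ℂ) (q : ℕ) : Polynomial ℂ :=
  (C (u 0 0) * X + C (u 1 0)) ^ q * (C (u 0 1) * X + C (u 1 1)) ^ (n - q)

/-- The squared norm `p! (n-p)!` of the monomial `x^p y^(n-p)`. -/
def formWeight (n p : ℕ) : ℝ := (p ! : ℝ) * ((n - p)! : ℝ)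

/-- The matrix of `u` on binary forms of degree `n`, in the orthonormal basis
`x^p y^(n-p) / √(p! (n-p)!)` (the Wigner matrix of spin `n/2`). -/
def spinMatrix (n : ℕ) (u : Matrix (Fin 2) (Fin 2) ℂ) :
    Matrix (Fin (n + 1)) (Fin (n + 1)) ℂ :=
  Matrix.of fun p q =>
    ((√(formWeight n p) / √(formWeight n q) : ℝ) : ℂ) * (binaryForm n u q).coeff p

theorem sqrt_formWeight_ne_zero (n p : ℕ) : √(formWeight n p) ≠ 0 := by
  unfold formWeight; positivity

theorem spinMatrix_one (n : ℕ) : spinMatrix n 1 = 1 := by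
  ext p q
  have h : binaryForm n 1 q = X ^ (q : ℕ) := by simp [binaryForm]
  by_cases hpq : p = q
  · subst hpq
    simp [spinMatrix, h, sqrt_formWeight_ne_zero n p]
  · have : (p : ℕ) ≠ q := fun e => hpq (Fin.ext e)
    simp [spinMatrix, h, Polynomial.coeff_X_pow, hpq, this]

theorem sum_binaryForm_mul (n : ℕ) (u : Matrix (Fin 2) (Fin 2) ℂ) (a b : ℂ) (f : Polynomial ℂ)
    (hf : f.natDegree ≤ n) :
    ∑ q ∈ Finset.range (n + 2), C (((C a * X + C b) * f).coeff q) * binaryForm (n + 1) u q =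
      (C a * (C (u 0 0) * X + C (u 1 0)) + C b * (C (u 0 1) * X + C (u 1 1))) *
        ∑ q ∈ Finset.range (n + 1), C (f.coeff q) * binaryForm n u q := by
  have h1 : ∑ q ∈ Finset.range (n + 2), C ((C b * f).coeff q) * binaryForm (n + 1) u q =
      C b * (C (u 0 1) * X + C (u 1 1)) *
        ∑ q ∈ Finset.range (n + 1), C (f.coeff q) * binaryForm n u q := by
    rw [Finset.sum_range_succ, Polynomial.coeff_C_mul,
      Polynomial.coeff_eq_zero_of_natDegree_lt (Nat.lt_succ_of_le hf), Finset.mul_sum]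
    simp only [mul_zero, map_zero, zero_mul, add_zero]
    refine Finset.sum_congr rfl fun q hq => ?_
    have hq' : q ≤ n := Nat.lt_succ_iff.mp (Finset.mem_range.mp hq)
    rw [Polynomial.coeff_C_mul, binaryForm, binaryForm, Nat.succ_sub hq', pow_succ]
    simp only [map_mul]
    ring
  have h2 : ∑ q ∈ Finset.range (n + 2), C ((C a * X * f).coeff q) * binaryForm (n + 1) u q =
      C a * (C (u 0 0) * X + C (u 1 0)) *
        ∑ q ∈ Finset.range (n + 1), C (f.coeff q) * binaryForm n u q := by
    rw [Finset.sum_range_succ', mul_assoc, Polynomial.coeff_C_mul, Polynomial.coeff_X_mul_zero,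
      Finset.mul_sum]
    simp only [mul_zero, map_zero, zero_mul, add_zero]
    refine Finset.sum_congr rfl fun q hq => ?_
    rw [Polynomial.coeff_C_mul, Polynomial.coeff_X_mul, binaryForm, binaryForm,
      Nat.succ_sub_succ, pow_succ]
    simp only [map_mul]
    ring
  rw [add_mul (C a * X) (C b) f]
  simp only [Polynomial.coeff_add, map_add, add_mul (C _) (C _) (binaryForm _ _ _),
    Finset.sum_add_distrib]
  rw [h1, h2]
  ring

theorem natDegree_linear_pow_mul (a b c d : ℂ) (r s : ℕ) :
    ((C a * X + C b) ^ r * (C c * X + C d) ^ s : Polynomial ℂ).natDegree ≤ r + s := by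
  refine Polynomial.natDegree_mul_le.trans (Nat.add_le_add ?_ ?_)
  · simpa using Polynomial.natDegree_pow_le_of_le r (Polynomial.natDegree_linear_le (a := a) (b := b))
  · simpa using Polynomial.natDegree_pow_le_of_le s (Polynomial.natDegree_linear_le (a := c) (b := d))

theorem sum_binaryForm_linear_pow (u : Matrix (Fin 2) (Fin 2) ℂ) (a b c d : ℂ) (r s : ℕ) :
    ∑ q ∈ Finset.range (r + s + 1),
        C (((C a * X + C b) ^ r * (C c * X + C d) ^ s : Polynomial ℂ).coeff q) *
          binaryForm (r + s) u q =
      (C a * (C (u 0 0) * X + C (u 1 0)) + C b * (C (u 0 1) * X + C (u 1 1))) ^ r *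
        (C c * (C (u 0 0) * X + C (u 1 0)) + C d * (C (u 0 1) * X + C (u 1 1))) ^ s := by
  induction r with
  | zero =>
    induction s with
    | zero => simp [binaryForm]
    | succ s ih =>
      have h := sum_binaryForm_mul (0 + s) u c d _ (natDegree_linear_pow_mul a b c d 0 s)
      rw [ih] at h
      have e : ((C a * X + C b) ^ 0 * (C c * X + C d) ^ (s + 1) : Polynomial ℂ) =
          (C c * X + C d) * ((C a * X + C b) ^ 0 * (C c * X + C d) ^ s) := by ring
      rw [e]
      refine h.trans ?_
      ring
  | succ r ih =>
    have h := sum_binaryForm_mul (r + s) u a b _ (natDegree_linear_pow_mul a b c d r s)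
    rw [ih] at h
    have e : ((C a * X + C b) ^ (r + 1) * (C c * X + C d) ^ s : Polynomial ℂ) =
        (C a * X + C b) * ((C a * X + C b) ^ r * (C c * X + C d) ^ s) := by ring
    rw [e, show r + 1 + s = r + s + 1 by ring]
    refine h.trans ?_
    ring

theorem binaryForm_mul (n : ℕ) (u v : Matrix (Fin 2) (Fin 2) ℂ) (q : ℕ) (hq : q ≤ n) :
    binaryForm n (u * v) q =
      ∑ r ∈ Finset.range (n + 1), C ((binaryForm n v q).coeff r) * binaryForm n u r := by
  obtain ⟨s, rfl⟩ := Nat.exists_eq_add_of_le hq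
  have h := sum_binaryForm_linear_pow u (v 0 0) (v 1 0) (v 0 1) (v 1 1) q s
  have e : binaryForm (q + s) v q =
      (C (v 0 0) * X + C (v 1 0)) ^ q * (C (v 0 1) * X + C (v 1 1)) ^ s := by
    simp [binaryForm]
  rw [e, h]
  simp only [binaryForm, Matrix.mul_apply, Fin.sum_univ_two, map_add, map_mul,
    Nat.add_sub_cancel_left]
  congr 2 <;> ring

theorem spinMatrix_mul (n : ℕ) (u v : Matrix (Fin 2) (Fin 2) ℂ) :
    spinMatrix n (u * v) = spinMatrix n u * spinMatrix n v := by
  ext p q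
  rw [Matrix.mul_apply]
  simp only [spinMatrix, Matrix.of_apply]
  rw [binaryForm_mul n u v q (Nat.lt_succ_iff.mp q.2), Finset.sum_range, Polynomial.finsetSum_coeff,
    Finset.mul_sum]
  refine Finset.sum_congr rfl fun r _ => ?_
  have hr : ((√(formWeight n r) : ℝ) : ℂ) ≠ 0 := by exact_mod_cast sqrt_formWeight_ne_zero n r
  have hq : ((√(formWeight n q) : ℝ) : ℂ) ≠ 0 := by exact_mod_cast sqrt_formWeight_ne_zero n q
  rw [Polynomial.coeff_C_mul]
  push_cast
  field_simp

/-- The standard representation `D_j` of `SU(2)` of spin `j = n/2`. -/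
def spinRep (n : ℕ) : Representation ℂ SU2 (SpinSpace n) where
  toFun u := Matrix.toEuclideanLin (spinMatrix n (u : Matrix (Fin 2) (Fin 2) ℂ))
  map_one' := by
    rw [Submonoid.coe_one, spinMatrix_one]
    ext x i
    simp
  map_mul' u v := by
    rw [Submonoid.coe_mul, spinMatrix_mul]
    ext x i
    simp [Matrix.mulVec_mulVec]

/-- The representation `(u, v) ↦ D_{j₁}(u) ⊗ D_{j₂}(v)` of `SU(2) × SU(2)`. -/
def pairRep (a b : ℕ) : Representation ℂ (SU2 × SU2) (SpinSpace a ⊗[ℂ] SpinSpace b) :=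
  Representation.tprod ((spinRep a).comp (MonoidHom.fst SU2 SU2))
    ((spinRep b).comp (MonoidHom.snd SU2 SU2))

/-- The diagonal representation `u ↦ D_{j₁}(u) ⊗ D_{j₂}(u)` of `SU(2)`. -/
def diagRep (a b : ℕ) : Representation ℂ SU2 (SpinSpace a ⊗[ℂ] SpinSpace b) :=
  Representation.tprod (spinRep a) (spinRep b)

/-- The part of the representation `ρ` of type `σ`: the span of the images of all intertwining maps
from `σ` to `ρ`.  For irreducible `σ` this is the isotypic component. -/
def isotypicPart {G V W : Type*} [Group G] [AddCommGroup V] [Module ℂ V] [AddCommGroup W]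
    [Module ℂ W] (σ : Representation ℂ G V) (ρ : Representation ℂ G W) : Submodule ℂ W :=
  ⨆ T : Representation.IntertwiningMap σ ρ, LinearMap.range T.toLinearMap

/-- The orthogonal projector onto a subspace of a finite-dimensional Hilbert space. -/
def orthProj {W : Type*} [NormedAddCommGroup W] [InnerProductSpace ℂ W] [FiniteDimensional ℂ W]
    (U : Submodule ℂ W) : W →ₗ[ℂ] W :=
  U.starProjection.toLinearMap

/-- The triangle condition `k ∈ ⟨j₁, j₂⟩ = {|j₁ - j₂|, |j₁ - j₂| + 1, ..., j₁ + j₂}`. -/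
def Triangle (a b c : ℕ) : Prop := Even (a + b + c) ∧ a ≤ b + c ∧ b ≤ a + c ∧ c ≤ a + b

instance (a b c : ℕ) : Decidable (Triangle a b c) := by unfold Triangle; infer_instance

/-- The set `⟨j₁, j₂⟩` of spins in the Clebsch-Gordan series of `j₁` and `j₂`. -/
def coupled (a b : ℕ) : Finset ℕ := (Finset.range (a + b + 1)).filter (Triangle a b)

/-- The two-spin projector `P^k_{j₁j₂}`: the orthogonal projector of `H_{j₁} ⊗ H_{j₂}` onto its
spin-`k` subspace under the diagonal action of `SU(2)`. -/
def twoSpinProj (a b k : ℕ) :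
    (SpinSpace a ⊗[ℂ] SpinSpace b) →ₗ[ℂ] (SpinSpace a ⊗[ℂ] SpinSpace b) :=
  orthProj (isotypicPart (spinRep k) (diagRep a b))

/-- The quasicharacter `χ^k_{j₁j₂}(u, v) = Tr (P^k_{j₁j₂} (D_{j₁}(u) ⊗ D_{j₂}(v)))`. -/
def quasichar (a b k : ℕ) (u v : SU2) : ℂ :=
  LinearMap.trace ℂ _ (twoSpinProj a b k ∘ₗ pairRep a b (u, v))

/-- The four-fold space `H_{j₁} ⊗ H_{j₂} ⊗ H_{j₁'} ⊗ H_{j₂'}`. -/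
abbrev FourSpace (a b a' b' : ℕ) : Type :=
  (SpinSpace a ⊗[ℂ] SpinSpace b) ⊗[ℂ] (SpinSpace a' ⊗[ℂ] SpinSpace b')

/-- The representation `(u, v) ↦ D_{j₁}(u) ⊗ D_{j₂}(v) ⊗ D_{j₁'}(u) ⊗ D_{j₂'}(v)`. -/
def fourRep (a b a' b' : ℕ) : Representation ℂ (SU2 × SU2) (FourSpace a b a' b') :=
  Representation.tprod (pairRep a b) (pairRep a' b')

/-- The orthogonal projector of the four-fold space onto the copy of `H_{J₁} ⊗ H_{J₂}` in it, as a
representation of `SU(2) × SU(2)`. -/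
def copyProj (a b a' b' J₁ J₂ : ℕ) : FourSpace a b a' b' →ₗ[ℂ] FourSpace a b a' b' :=
  orthProj (W := FourSpace a b a' b') (isotypicPart (pairRep J₁ J₂) (fourRep a b a' b'))

/-- The grand projector `P^K_{J₁J₂}` on the four-fold space: the orthogonal projector onto the
spin-`K` subspace of the copy of `H_{J₁} ⊗ H_{J₂}` in it, that is, onto the image of the range of
the two-spin projector `P^K_{J₁J₂}` under the `SU(2) × SU(2)`-intertwining maps from
`H_{J₁} ⊗ H_{J₂}` to the four-fold space. -/
def grandProj (a b a' b' J₁ J₂ K : ℕ) : FourSpace a b a' b' →ₗ[ℂ] FourSpace a b a' b' :=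
  orthProj (W := FourSpace a b a' b') (⨆ T : Representation.IntertwiningMap (pairRep J₁ J₂) (fourRep a b a' b'),
    (LinearMap.range (twoSpinProj J₁ J₂ K)).map T.toLinearMap)

/-- The part of an operator on the four-fold space that is block diagonal with respect to the
decomposition of that space into the copies of the `H_{J₁} ⊗ H_{J₂}`. -/
def blockDiagPart (a b a' b' : ℕ) (A : FourSpace a b a' b' →ₗ[ℂ] FourSpace a b a' b') :
    FourSpace a b a' b' →ₗ[ℂ] FourSpace a b a' b' :=
  ∑ J₁ ∈ coupled a a', ∑ J₂ ∈ coupled b b',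
    copyProj a b a' b' J₁ J₂ ∘ₗ A ∘ₗ copyProj a b a' b' J₁ J₂

/-- The Wigner `3j` symbol `(j₁ j₂ j₃; m₁ m₂ m₃)`, by Racah's formula, for `j₁ = a/2`, `j₂ = b/2`,
`j₃ = c/2` and `p = j₁ + m₁`, `q = j₂ + m₂`, `r = j₃ + m₃`.  With `S = j₁ + j₂ + j₃`,
`j₁ + j₂ - j₃ = S - c`, `j₃ - j₂ + m₁ = p - (S - c)`, `j₃ - j₁ - m₂ = (b - q) - (S - c)` and
`j₁ - j₂ - m₃ = S - b - r`; the sum runs over the `s` for which all six factorials have nonnegative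
arguments.  The symbol is zero unless the triangle condition and `m₁ + m₂ + m₃ = 0` hold. -/
def threeJ (a b c : ℕ) (p : Fin (a + 1)) (q : Fin (b + 1)) (r : Fin (c + 1)) : ℝ :=
  if Triangle a b c ∧ 2 * ((p : ℕ) + q + r) = a + b + c then
    let S : ℕ := (a + b + c) / 2
    (-1 : ℝ) ^ ((S : ℤ) - b - (r : ℕ)) *
      √(((S - c)! * (S - b)! * (S - a)! : ℝ) / ((S + 1)! : ℝ)) *
      √((p : ℕ)! * (a - p)! * (q : ℕ)! * (b - q)! * (r : ℕ)! * (c - r)! : ℝ) *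
      ∑ s ∈ (Finset.range (S + 1)).filter (fun s =>
          s ≤ S - c ∧ s ≤ a - p ∧ s ≤ q ∧ S - c ≤ p + s ∧ S - c ≤ b - q + s),
        (-1 : ℝ) ^ s / ((s)! * (S - c - s)! * (a - p - s)! * (q - s)! *
          (p + s - (S - c))! * (b - q + s - (S - c))! : ℝ)
  else 0

/-- The `9j` symbol with rows `(a₁ a₂ a₃)`, `(b₁ b₂ b₃)`, `(c₁ c₂ c₃)` (as Dynkin labels): the sum,
over all nine magnetic quantum numbers, of the product of the `3j` symbols of the rows and of the
columns. -/
def nineJ (a₁ a₂ a₃ b₁ b₂ b₃ c₁ c₂ c₃ : ℕ) : ℝ :=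
  ∑ p₁ : Fin (a₁ + 1), ∑ p₂ : Fin (a₂ + 1), ∑ p₃ : Fin (a₃ + 1),
  ∑ q₁ : Fin (b₁ + 1), ∑ q₂ : Fin (b₂ + 1), ∑ q₃ : Fin (b₃ + 1),
  ∑ r₁ : Fin (c₁ + 1), ∑ r₂ : Fin (c₂ + 1), ∑ r₃ : Fin (c₃ + 1),
    threeJ a₁ a₂ a₃ p₁ p₂ p₃ * threeJ b₁ b₂ b₃ q₁ q₂ q₃ * threeJ c₁ c₂ c₃ r₁ r₂ r₃ *
    (threeJ a₁ b₁ c₁ p₁ q₁ r₁ * threeJ a₂ b₂ c₂ p₂ q₂ r₂ * threeJ a₃ b₃ c₃ p₃ q₃ r₃)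

/-- The structure constant `[J₁][J₂][k][k'] {j₁ j₂ k; j₁' j₂' k'; J₁ J₂ K}²`. -/
def structConst (j₁ j₂ k j₁' j₂' k' J₁ J₂ K : ℕ) : ℂ :=
  (((J₁ + 1 : ℝ) * (J₂ + 1) * (k + 1) * (k' + 1) *
    nineJ j₁ j₂ k j₁' j₂' k' J₁ J₂ K ^ 2 : ℝ) : ℂ)

end SpinRecoupling

end

/-! The couplings `H_k ⊗ H_{k'} → H` (pairing `j₁, j₂` and `j₁', j₂'`) and `H_{J₁} ⊗ H_{J₂} → H`
(pairing `j₁, j₁'` and `j₂, j₂'`) are isometric embeddings; following the first by the adjoint of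
the second gives the recoupling operator `R : H_k ⊗ H_{k'} → H_{J₁} ⊗ H_{J₂}`.  It commutes with
the diagonal action of `SU(2)`, and both sides contain each spin `K` at most once, so by Schur's
lemma it maps the spin-`K` vectors of one side to those of the other by a scalar.  This scalar can
be read off a trace in ladder bases, where the couplings have `3j` symbols as matrix entries: it is
`√([J₁][J₂][k][k'])` times the `9j` symbol.  Compressing `P^k ⊗ P^{k'}` to the copy of
`H_{J₁} ⊗ H_{J₂}` gives `R R†` there, whose eigenvalues are the squares of these scalars.  Finally,
the trace of `A D(u, v)` depends only on the block-diagonal part of `A`, because `D(u, v)` preserves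
the blocks. -/

noncomputable section

namespace SpinRecoupling

/-! ### Schur's lemma and multiplicity-free decompositions -/

section LinearAlgebra

theorem linearMap_sum_comp {R ι U V W : Type*} [Semiring R] [AddCommMonoid U] [AddCommMonoid V]
    [AddCommMonoid W] [Module R U] [Module R V] [Module R W] (s : Finset ι) (f : ι → V →ₗ[R] W)
    (g : U →ₗ[R] V) : (∑ i ∈ s, f i) ∘ₗ g = ∑ i ∈ s, f i ∘ₗ g := by
  ext; simp

theorem linearMap_comp_sum {R ι U V W : Type*} [Semiring R] [AddCommMonoid U] [AddCommMonoid V]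
    [AddCommMonoid W] [Module R U] [Module R V] [Module R W] (s : Finset ι) (f : ι → U →ₗ[R] V)
    (g : V →ₗ[R] W) : g ∘ₗ (∑ i ∈ s, f i) = ∑ i ∈ s, g ∘ₗ f i := by
  ext; simp

theorem range_orthProj {W : Type*} [NormedAddCommGroup W] [InnerProductSpace ℂ W]
    [FiniteDimensional ℂ W] (U : Submodule ℂ W) : LinearMap.range (orthProj U) = U :=
  Submodule.range_starProjection U

theorem orthProj_map {V W : Type*} [NormedAddCommGroup V] [InnerProductSpace ℂ V]
    [FiniteDimensional ℂ V] [NormedAddCommGroup W] [InnerProductSpace ℂ W] [FiniteDimensional ℂ W]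
    {T : V →ₗ[ℂ] W} (hT : LinearMap.adjoint T ∘ₗ T = LinearMap.id) (U : Submodule ℂ V) :
    orthProj (U.map T) = T ∘ₗ orthProj U ∘ₗ LinearMap.adjoint T := by
  ext x
  refine Submodule.eq_starProjection_of_mem_of_inner_eq_zero (K := U.map T)
    ⟨_, Submodule.starProjection_apply_mem U (LinearMap.adjoint T x), rfl⟩ ?_
  rintro _ ⟨y, hy, rfl⟩
  have hT' (z : V) : LinearMap.adjoint T (T z) = z := LinearMap.congr_fun hT z
  rw [← LinearMap.adjoint_inner_left, map_sub, LinearMap.comp_apply, hT']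
  exact Submodule.starProjection_inner_eq_zero _ _ hy

theorem adjoint_isometryEquiv {V W : Type*} [NormedAddCommGroup V] [InnerProductSpace ℂ V]
    [FiniteDimensional ℂ V] [NormedAddCommGroup W] [InnerProductSpace ℂ W] [FiniteDimensional ℂ W]
    (e : V ≃ₗᵢ[ℂ] W) :
    LinearMap.adjoint e.toLinearEquiv.toLinearMap = e.symm.toLinearEquiv.toLinearMap :=
  ((LinearMap.eq_adjoint_iff _ _).2 fun w v => by
    simpa using e.symm.inner_map_eq_flip w v).symm

theorem trace_idempotent_compression_comp {R V : Type*} [CommRing R] [AddCommGroup V] [Module R V]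
    {Q B : Module.End R V} (hQ : IsIdempotentElem Q) (hQB : Q * B = B * Q)
    (A : Module.End R V) :
    LinearMap.trace R V (Q * (A * Q) * B) = LinearMap.trace R V (A * B * Q) := by
  rw [mul_assoc, LinearMap.trace_mul_comm, mul_assoc A, mul_assoc A, mul_assoc Q, ← hQB,
    ← mul_assoc Q, hQ.eq, hQB, mul_assoc]

end LinearAlgebra

section Intertwining

variable {k G U V W U' V' : Type*} [CommSemiring k] [Monoid G]
  [AddCommMonoid U] [Module k U] [AddCommMonoid V] [Module k V] [AddCommMonoid W] [Module k W]
  [AddCommMonoid U'] [Module k U'] [AddCommMonoid V'] [Module k V']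
  {σ : Representation k G U} {ρ : Representation k G V} {π : Representation k G W}
  {σ' : Representation k G U'} {ρ' : Representation k G V'}

theorem isIntertwiningMap_iff_comp_eq {A : U →ₗ[k] V} :
    σ.IsIntertwiningMap ρ A ↔ ∀ g, A ∘ₗ σ g = ρ g ∘ₗ A := by
  simp only [Representation.isIntertwiningMap_iff, LinearMap.ext_iff, LinearMap.comp_apply]

theorem isIntertwiningMap_comp {B : V →ₗ[k] W} {A : U →ₗ[k] V} (hB : ρ.IsIntertwiningMap π B)
    (hA : σ.IsIntertwiningMap ρ A) : σ.IsIntertwiningMap π (B ∘ₗ A) where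
  isIntertwining g x := by
    rw [LinearMap.comp_apply, LinearMap.comp_apply, hA.isIntertwining, hB.isIntertwining]

theorem isIntertwiningMap_tensorProduct_map {A : U →ₗ[k] V} {B : U' →ₗ[k] V'}
    (hA : σ.IsIntertwiningMap ρ A) (hB : σ'.IsIntertwiningMap ρ' B) :
    (σ.tprod σ').IsIntertwiningMap (ρ.tprod ρ') (TensorProduct.map A B) := by
  rw [isIntertwiningMap_iff_comp_eq] at hA hB ⊢
  intro g
  rw [Representation.tprod_apply, Representation.tprod_apply, ← TensorProduct.map_comp,
    ← TensorProduct.map_comp, hA g, hB g]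

theorem isIntertwiningMap_restrict {H : Type*} [Monoid H] {A : U →ₗ[k] V}
    (hA : σ.IsIntertwiningMap ρ A) (f : H →* G) :
    Representation.IsIntertwiningMap (σ.comp f) (ρ.comp f) A where
  isIntertwining h := hA.isIntertwining (f h)

end Intertwining

section OuterTensor

variable {k G H V W V' W' : Type*} [CommSemiring k] [Monoid G] [Monoid H]
  [AddCommMonoid V] [Module k V] [AddCommMonoid W] [Module k W]
  [AddCommMonoid V'] [Module k V'] [AddCommMonoid W'] [Module k W']

/-- The external tensor product `(g, h) ↦ σ(g) ⊗ τ(h)` of representations of `G` and of `H`. -/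
def outerTensor (σ : Representation k G V) (τ : Representation k H W) :
    Representation k (G × H) (V ⊗[k] W) :=
  Representation.tprod (σ.comp (MonoidHom.fst G H)) (τ.comp (MonoidHom.snd G H))

theorem isIntertwiningMap_outerTensor_map {σ : Representation k G V} {τ : Representation k H W}
    {σ' : Representation k G V'} {τ' : Representation k H W'} {A : V →ₗ[k] V'} {B : W →ₗ[k] W'}
    (hA : σ.IsIntertwiningMap σ' A) (hB : τ.IsIntertwiningMap τ' B) :
    (outerTensor σ τ).IsIntertwiningMap (outerTensor σ' τ') (TensorProduct.map A B) :=
  isIntertwiningMap_tensorProduct_map (isIntertwiningMap_restrict hA _)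
    (isIntertwiningMap_restrict hB _)

theorem isIntertwiningMap_mk (σ : Representation k G V) (τ : Representation k H W) (v : V) :
    τ.IsIntertwiningMap ((outerTensor σ τ).comp (MonoidHom.inr G H))
      (TensorProduct.mk k V W v) where
  isIntertwining h w := by simp [outerTensor]

theorem isIntertwiningMap_mk_flip (σ : Representation k G V) (τ : Representation k H W) (w : W) :
    σ.IsIntertwiningMap ((outerTensor σ τ).comp (MonoidHom.inl G H))
      ((TensorProduct.mk k V W).flip w) where
  isIntertwining g v := by simp [outerTensor]

end OuterTensor

section Unitary

variable {G H V W : Type*} [Group G] [Group H]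
  [NormedAddCommGroup V] [InnerProductSpace ℂ V] [FiniteDimensional ℂ V]
  [NormedAddCommGroup W] [InnerProductSpace ℂ W] [FiniteDimensional ℂ W]
  {σ : Representation ℂ G V} {ρ : Representation ℂ G W}

/-- A representation by unitary operators. -/
def IsUnitaryRep (ρ : Representation ℂ G W) : Prop :=
  ∀ g, LinearMap.adjoint (ρ g) = ρ g⁻¹

theorem IsUnitaryRep.tprod (hσ : IsUnitaryRep σ) (hρ : IsUnitaryRep ρ) :
    IsUnitaryRep (σ.tprod ρ) := fun g => by
  rw [Representation.tprod_apply, TensorProduct.adjoint_map, hσ, hρ, ← Representation.tprod_apply]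

theorem IsUnitaryRep.restrict (hρ : IsUnitaryRep ρ) (f : H →* G) :
    IsUnitaryRep (W := W) (ρ.comp f) := fun h => by
  simp only [MonoidHom.comp_apply, map_inv, hρ (f h)]

theorem IsUnitaryRep.outerTensor (hσ : IsUnitaryRep σ) {τ : Representation ℂ H W}
    (hτ : IsUnitaryRep τ) : IsUnitaryRep (outerTensor σ τ) :=
  (hσ.restrict _).tprod (hτ.restrict _)

theorem isIntertwiningMap_adjoint (hσ : IsUnitaryRep σ) (hρ : IsUnitaryRep ρ) {T : V →ₗ[ℂ] W}
    (hT : σ.IsIntertwiningMap ρ T) : ρ.IsIntertwiningMap σ (LinearMap.adjoint T) := by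
  rw [isIntertwiningMap_iff_comp_eq] at hT ⊢
  intro g
  have h := congrArg LinearMap.adjoint (hT g⁻¹)
  rw [LinearMap.adjoint_comp, LinearMap.adjoint_comp, hσ, hρ, inv_inv] at h
  exact h.symm

end Unitary

section Slice

variable {V W V' W' : Type*}
  [NormedAddCommGroup V] [InnerProductSpace ℂ V] [NormedAddCommGroup W] [InnerProductSpace ℂ W]
  [NormedAddCommGroup V'] [InnerProductSpace ℂ V'] [NormedAddCommGroup W'] [InnerProductSpace ℂ W']

theorem linearMap_ext_inner_tmul {A B : V ⊗[ℂ] W →ₗ[ℂ] V' ⊗[ℂ] W'}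
    (h : ∀ v w v' w', inner ℂ (v' ⊗ₜ[ℂ] w') (A (v ⊗ₜ w)) = inner ℂ (v' ⊗ₜ[ℂ] w') (B (v ⊗ₜ w))) :
    A = B :=
  TensorProduct.ext' fun v w => TensorProduct.ext_iff_inner_left.2 fun v' w' => h v w v' w'

variable [FiniteDimensional ℂ V'] [FiniteDimensional ℂ W']

/-- The partial matrix element `⟨w'| A |w⟩` of `A` in the second tensor factor. -/
def leftSlice (A : V ⊗[ℂ] W →ₗ[ℂ] V' ⊗[ℂ] W') (w : W) (w' : W') : V →ₗ[ℂ] V' :=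
  LinearMap.adjoint ((TensorProduct.mk ℂ V' W').flip w') ∘ₗ A ∘ₗ (TensorProduct.mk ℂ V W).flip w

/-- The partial matrix element `⟨v'| A |v⟩` of `A` in the first tensor factor. -/
def rightSlice (A : V ⊗[ℂ] W →ₗ[ℂ] V' ⊗[ℂ] W') (v : V) (v' : V') : W →ₗ[ℂ] W' :=
  LinearMap.adjoint (TensorProduct.mk ℂ V' W' v') ∘ₗ A ∘ₗ TensorProduct.mk ℂ V W v

theorem inner_leftSlice (A : V ⊗[ℂ] W →ₗ[ℂ] V' ⊗[ℂ] W') (v : V) (w : W) (v' : V') (w' : W') :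
    inner ℂ v' (leftSlice A w w' v) = inner ℂ (v' ⊗ₜ[ℂ] w') (A (v ⊗ₜ w)) := by
  rw [leftSlice, LinearMap.comp_apply, LinearMap.adjoint_inner_right]
  simp only [LinearMap.comp_apply, LinearMap.flip_apply, TensorProduct.mk_apply]

theorem inner_rightSlice (A : V ⊗[ℂ] W →ₗ[ℂ] V' ⊗[ℂ] W') (v : V) (w : W) (v' : V') (w' : W') :
    inner ℂ w' (rightSlice A v v' w) = inner ℂ (v' ⊗ₜ[ℂ] w') (A (v ⊗ₜ w)) := by
  rw [rightSlice, LinearMap.comp_apply, LinearMap.adjoint_inner_right]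
  simp only [LinearMap.comp_apply, TensorProduct.mk_apply]

end Slice

section SliceIntertwining

variable {G H V W V' W' : Type*} [Group G] [Group H]
  [NormedAddCommGroup V] [InnerProductSpace ℂ V] [NormedAddCommGroup W] [InnerProductSpace ℂ W]
  [NormedAddCommGroup V'] [InnerProductSpace ℂ V'] [FiniteDimensional ℂ V']
  [NormedAddCommGroup W'] [InnerProductSpace ℂ W'] [FiniteDimensional ℂ W']
  {σ : Representation ℂ G V} {τ : Representation ℂ H W}
  {σ' : Representation ℂ G V'} {τ' : Representation ℂ H W'} {A : V ⊗[ℂ] W →ₗ[ℂ] V' ⊗[ℂ] W'}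

theorem isIntertwiningMap_leftSlice (hσ' : IsUnitaryRep σ') (hτ' : IsUnitaryRep τ')
    (hA : (outerTensor σ τ).IsIntertwiningMap (outerTensor σ' τ') A) (w : W) (w' : W') :
    σ.IsIntertwiningMap σ' (leftSlice A w w') :=
  isIntertwiningMap_comp
    (isIntertwiningMap_adjoint hσ' ((hσ'.outerTensor hτ').restrict (MonoidHom.inl G H))
      (isIntertwiningMap_mk_flip σ' τ' w'))
    (isIntertwiningMap_comp (isIntertwiningMap_restrict hA (MonoidHom.inl G H))
      (isIntertwiningMap_mk_flip σ τ w))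

theorem isIntertwiningMap_rightSlice (hσ' : IsUnitaryRep σ') (hτ' : IsUnitaryRep τ')
    (hA : (outerTensor σ τ).IsIntertwiningMap (outerTensor σ' τ') A) (v : V) (v' : V') :
    τ.IsIntertwiningMap τ' (rightSlice A v v') :=
  isIntertwiningMap_comp
    (isIntertwiningMap_adjoint hτ' ((hσ'.outerTensor hτ').restrict (MonoidHom.inr G H))
      (isIntertwiningMap_mk σ' τ' v'))
    (isIntertwiningMap_comp (isIntertwiningMap_restrict hA (MonoidHom.inr G H))
      (isIntertwiningMap_mk σ τ v))

end SliceIntertwining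

section SchurFamily

variable {G H ι κ : Type*} [Group G] [Group H]
  {V : ι → Type*} [∀ i, NormedAddCommGroup (V i)] [∀ i, InnerProductSpace ℂ (V i)]
  [∀ i, FiniteDimensional ℂ (V i)]
  {W : κ → Type*} [∀ k, NormedAddCommGroup (W k)] [∀ k, InnerProductSpace ℂ (W k)]
  [∀ k, FiniteDimensional ℂ (W k)]
  {σ : ∀ i, Representation ℂ G (V i)} {τ : ∀ k, Representation ℂ H (W k)}

/-- A family of unitary representations satisfying the conclusion of Schur's lemma, that is, a
family of pairwise inequivalent irreducible unitary representations. -/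
structure IsSchurFamily (σ : ∀ i, Representation ℂ G (V i)) : Prop where
  isUnitaryRep (i : ι) : IsUnitaryRep (σ i)
  eq_zero {i j : ι} (hij : i ≠ j) {A : V i →ₗ[ℂ] V j} (hA : (σ i).IsIntertwiningMap (σ j) A) : A = 0
  exists_eq_smul_id {i : ι} {A : V i →ₗ[ℂ] V i} (hA : (σ i).IsIntertwiningMap (σ i) A) :
    ∃ c : ℂ, A = c • LinearMap.id

theorem outerTensor_exists_eq_smul_id (hσ : IsSchurFamily σ) (hτ : IsSchurFamily τ) {i : ι} {k : κ}
    {A : V i ⊗[ℂ] W k →ₗ[ℂ] V i ⊗[ℂ] W k}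
    (hA : (outerTensor (σ i) (τ k)).IsIntertwiningMap (outerTensor (σ i) (τ k)) A) :
    ∃ c : ℂ, A = c • LinearMap.id := by
  rcases subsingleton_or_nontrivial (V i) with hV | hV
  · exact ⟨0, TensorProduct.ext' fun v w => by simp [Subsingleton.elim v 0]⟩
  obtain ⟨v₀, hv₀⟩ := exists_ne (0 : V i)
  obtain ⟨d, hd⟩ := hτ.exists_eq_smul_id (isIntertwiningMap_rightSlice (hσ.isUnitaryRep i)
    (hτ.isUnitaryRep k) hA v₀ v₀)
  refine ⟨d / inner ℂ v₀ v₀, linearMap_ext_inner_tmul fun v w v' w' => ?_⟩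
  obtain ⟨c, hc⟩ := hσ.exists_eq_smul_id (isIntertwiningMap_leftSlice (hσ.isUnitaryRep i)
    (hτ.isUnitaryRep k) hA w w')
  have hcd : c * inner ℂ v₀ v₀ = d * inner ℂ w' w := by
    have hl := inner_leftSlice A v₀ w v₀ w'
    have hr := inner_rightSlice A v₀ w v₀ w'
    simp only [hc, hd, LinearMap.smul_apply, LinearMap.id_apply, inner_smul_right] at hl hr
    rw [hl, hr]
  have hv : inner ℂ v₀ v₀ ≠ 0 := inner_self_ne_zero.2 hv₀
  rw [← inner_leftSlice, hc]
  simp only [LinearMap.smul_apply, LinearMap.id_apply, inner_smul_right, TensorProduct.inner_tmul]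
  rw [eq_div_of_mul_eq hv hcd]
  ring

theorem IsSchurFamily.outerTensor (hσ : IsSchurFamily σ) (hτ : IsSchurFamily τ) :
    IsSchurFamily (V := fun p : ι × κ => V p.1 ⊗[ℂ] W p.2)
      fun p => outerTensor (σ p.1) (τ p.2) where
  isUnitaryRep p := (hσ.isUnitaryRep p.1).outerTensor (hτ.isUnitaryRep p.2)
  eq_zero {p q} hpq A hA := by
    refine linearMap_ext_inner_tmul fun v w v' w' => ?_
    by_cases h : p.1 = q.1
    · have h' : p.2 ≠ q.2 := fun h' => hpq (Prod.ext h h')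
      rw [← inner_rightSlice, hτ.eq_zero h' (isIntertwiningMap_rightSlice (hσ.isUnitaryRep _)
        (hτ.isUnitaryRep _) hA v v')]
      simp
    · rw [← inner_leftSlice, hσ.eq_zero h (isIntertwiningMap_leftSlice (hσ.isUnitaryRep _)
        (hτ.isUnitaryRep _) hA w w')]
      simp
  exists_eq_smul_id hA := outerTensor_exists_eq_smul_id hσ hτ hA

end SchurFamily

section Decomposition

variable {G ι : Type*} [Group G]
  {V : ι → Type*} [∀ i, NormedAddCommGroup (V i)] [∀ i, InnerProductSpace ℂ (V i)]
  [∀ i, FiniteDimensional ℂ (V i)]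
  {W W' : Type*} [NormedAddCommGroup W] [InnerProductSpace ℂ W] [FiniteDimensional ℂ W]
  [NormedAddCommGroup W'] [InnerProductSpace ℂ W'] [FiniteDimensional ℂ W']
  {σ : ∀ i, Representation ℂ G (V i)} {ρ : Representation ℂ G W} {ρ' : Representation ℂ G W'}
  {s s' : Finset ι} {T : ∀ i, V i →ₗ[ℂ] W} {T' : ∀ i, V i →ₗ[ℂ] W'}

/-- `ρ` is the orthogonal direct sum of one copy of each of the irreducible representations `σ i`,
`i ∈ s`, embedded by the isometries `T i`.  For `i ∉ s` the intertwining map `T i` is then zero. -/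
structure IsMultFreeDecomp (σ : ∀ i, Representation ℂ G (V i)) (ρ : Representation ℂ G W)
    (s : Finset ι) (T : ∀ i, V i →ₗ[ℂ] W) : Prop where
  isSchurFamily : IsSchurFamily σ
  isUnitaryRep : IsUnitaryRep ρ
  isIntertwiningMap (i : ι) : (σ i).IsIntertwiningMap ρ (T i)
  adjoint_comp_self {i : ι} (hi : i ∈ s) : LinearMap.adjoint (T i) ∘ₗ T i = LinearMap.id
  sum_comp_adjoint : ∑ i ∈ s, T i ∘ₗ LinearMap.adjoint (T i) = LinearMap.id

theorem adjoint_comp_eq_zero_of_ne (hσ : IsSchurFamily σ) (hρ : IsUnitaryRep ρ) {i j : ι}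
    (hij : i ≠ j) {A : V i →ₗ[ℂ] W} {B : V j →ₗ[ℂ] W} (hA : (σ i).IsIntertwiningMap ρ A)
    (hB : (σ j).IsIntertwiningMap ρ B) : LinearMap.adjoint A ∘ₗ B = 0 :=
  hσ.eq_zero hij.symm <|
    isIntertwiningMap_comp (isIntertwiningMap_adjoint (hσ.isUnitaryRep i) hρ hA) hB

theorem IsMultFreeDecomp.of_finrank (hσ : IsSchurFamily σ) (hρ : IsUnitaryRep ρ)
    (hT : ∀ i, (σ i).IsIntertwiningMap ρ (T i))
    (hiso : ∀ i ∈ s, LinearMap.adjoint (T i) ∘ₗ T i = LinearMap.id)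
    (hdim : Module.finrank ℂ W = ∑ i ∈ s, Module.finrank ℂ (V i)) :
    IsMultFreeDecomp σ ρ s T where
  isSchurFamily := hσ
  isUnitaryRep := hρ
  isIntertwiningMap := hT
  adjoint_comp_self {i} := hiso i
  sum_comp_adjoint := by
    set Q : Module.End ℂ W := ∑ i ∈ s, T i ∘ₗ LinearMap.adjoint (T i) with hQ
    have hQT {i : ι} (hi : i ∈ s) : Q ∘ₗ T i = T i := by
      rw [hQ, linearMap_sum_comp, Finset.sum_eq_single_of_mem i hi fun j _ hj => by
        rw [LinearMap.comp_assoc, adjoint_comp_eq_zero_of_ne hσ hρ hj (hT j) (hT i),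
          LinearMap.comp_zero], LinearMap.comp_assoc, hiso i hi, LinearMap.comp_id]
    have hidem : IsIdempotentElem Q := by
      change Q ∘ₗ Q = Q
      nth_rw 2 [hQ]
      rw [linearMap_comp_sum]
      exact Finset.sum_congr rfl fun i hi => by rw [← LinearMap.comp_assoc, hQT hi]
    have htrace : LinearMap.trace ℂ W Q = Module.finrank ℂ W := by
      rw [hQ, map_sum, hdim, Nat.cast_sum]
      exact Finset.sum_congr rfl fun i hi => by
        rw [LinearMap.trace_comp_comm', hiso i hi, LinearMap.trace_id]
    have hcompl : 1 - Q = 0 :=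
      LinearMap.IsIdempotentElem.eq_zero_of_trace_eq_zero hidem.one_sub <| by
        rw [map_sub, htrace, LinearMap.trace_one, sub_self]
    exact (sub_eq_zero.1 hcompl).symm

namespace IsMultFreeDecomp

theorem eq_sum (h : IsMultFreeDecomp σ ρ s T) {U : Type*} [AddCommMonoid U] [Module ℂ U]
    (A : U →ₗ[ℂ] W) : A = ∑ i ∈ s, T i ∘ₗ LinearMap.adjoint (T i) ∘ₗ A := by
  simp_rw [← LinearMap.comp_assoc]
  rw [← linearMap_sum_comp, h.sum_comp_adjoint, LinearMap.id_comp]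

theorem exists_eq_smul (h : IsMultFreeDecomp σ ρ s T) {i : ι} (hi : i ∈ s) {A : V i →ₗ[ℂ] W}
    (hA : (σ i).IsIntertwiningMap ρ A) : ∃ c : ℂ, A = c • T i := by
  obtain ⟨c, hc⟩ := h.isSchurFamily.exists_eq_smul_id <| isIntertwiningMap_comp
    (isIntertwiningMap_adjoint (h.isSchurFamily.isUnitaryRep i) h.isUnitaryRep
      (h.isIntertwiningMap i)) hA
  refine ⟨c, ?_⟩
  rw [h.eq_sum A, Finset.sum_eq_single_of_mem i hi fun j _ hj => by
    rw [adjoint_comp_eq_zero_of_ne h.isSchurFamily h.isUnitaryRep hj (h.isIntertwiningMap j) hA,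
      LinearMap.comp_zero], hc, LinearMap.comp_smul, LinearMap.comp_id]

theorem eq_zero_of_notMem (h : IsMultFreeDecomp σ ρ s T) {i : ι} (hi : i ∉ s) {A : V i →ₗ[ℂ] W}
    (hA : (σ i).IsIntertwiningMap ρ A) : A = 0 := by
  rw [h.eq_sum A]
  refine Finset.sum_eq_zero fun j hj => ?_
  rw [adjoint_comp_eq_zero_of_ne h.isSchurFamily h.isUnitaryRep (ne_of_mem_of_not_mem hj hi)
    (h.isIntertwiningMap j) hA, LinearMap.comp_zero]

theorem eq_smul_of_trace_eq (h : IsMultFreeDecomp σ ρ s T) {i : ι} [Nontrivial (V i)]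
    {A : V i →ₗ[ℂ] W} (hA : (σ i).IsIntertwiningMap ρ A) {c : ℂ}
    (hc : LinearMap.trace ℂ (V i) (LinearMap.adjoint (T i) ∘ₗ A) = c * Module.finrank ℂ (V i)) :
    A = c • T i := by
  by_cases hi : i ∈ s
  · obtain ⟨z, hz⟩ := h.exists_eq_smul hi hA
    rw [hz, LinearMap.comp_smul, h.adjoint_comp_self hi, map_smul, LinearMap.trace_id,
      smul_eq_mul] at hc
    rw [hz, mul_right_cancel₀ (Nat.cast_ne_zero.2 Module.finrank_pos.ne') hc]
  · rw [h.eq_zero_of_notMem hi hA, h.eq_zero_of_notMem hi (h.isIntertwiningMap i), smul_zero]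

theorem sum_comp_adjoint_of_subset (h : IsMultFreeDecomp σ ρ s T) {t : Finset ι} (hst : s ⊆ t) :
    ∑ i ∈ t, T i ∘ₗ LinearMap.adjoint (T i) = LinearMap.id := by
  rw [← h.sum_comp_adjoint]
  exact (Finset.sum_subset hst fun i _ hi => by
    rw [h.eq_zero_of_notMem hi (h.isIntertwiningMap i), LinearMap.zero_comp]).symm

theorem iSup_map_intertwiningMap (h : IsMultFreeDecomp σ ρ s T) {i : ι} (hi : i ∈ s)
    (U : Submodule ℂ (V i)) :
    ⨆ A : Representation.IntertwiningMap (σ i) ρ, U.map A.toLinearMap = U.map (T i) := by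
  refine le_antisymm (iSup_le fun A => ?_) ?_
  · obtain ⟨c, hc⟩ := h.exists_eq_smul hi (isIntertwiningMap_iff_comp_eq.2 A.isIntertwining')
    rw [hc]
    rintro _ ⟨x, hx, rfl⟩
    exact ⟨c • x, U.smul_mem c hx, map_smul (T i) c x⟩
  · exact le_iSup (fun A : Representation.IntertwiningMap (σ i) ρ => U.map A.toLinearMap)
      ⟨T i, isIntertwiningMap_iff_comp_eq.1 (h.isIntertwiningMap i)⟩

theorem orthProj_iSup_map_intertwiningMap (h : IsMultFreeDecomp σ ρ s T) {i : ι} (hi : i ∈ s)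
    (U : Submodule ℂ (V i)) :
    orthProj (⨆ A : Representation.IntertwiningMap (σ i) ρ, U.map A.toLinearMap) =
      T i ∘ₗ orthProj U ∘ₗ LinearMap.adjoint (T i) := by
  rw [h.iSup_map_intertwiningMap hi, orthProj_map (h.adjoint_comp_self hi)]

theorem orthProj_isotypicPart (h : IsMultFreeDecomp σ ρ s T) {i : ι} (hi : i ∈ s) :
    orthProj (isotypicPart (σ i) ρ) = T i ∘ₗ LinearMap.adjoint (T i) := by
  have htop : orthProj (⊤ : Submodule ℂ (V i)) = LinearMap.id := by
    ext x
    exact Submodule.starProjection_eq_self_iff.2 Submodule.mem_top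
  simp only [isotypicPart, LinearMap.range_eq_map, h.orthProj_iSup_map_intertwiningMap hi, htop,
    LinearMap.id_comp]

theorem trace_comp_eq_trace_blockDiag (h : IsMultFreeDecomp σ ρ s T) (A : W →ₗ[ℂ] W) (g : G) :
    LinearMap.trace ℂ W (A ∘ₗ ρ g) =
      LinearMap.trace ℂ W ((∑ i ∈ s, orthProj (isotypicPart (σ i) ρ) ∘ₗ A ∘ₗ
        orthProj (isotypicPart (σ i) ρ)) ∘ₗ ρ g) := by
  have hterm {i : ι} (hi : i ∈ s) :
      LinearMap.trace ℂ W ((orthProj (isotypicPart (σ i) ρ) ∘ₗ A ∘ₗ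
        orthProj (isotypicPart (σ i) ρ)) ∘ₗ ρ g) =
      LinearMap.trace ℂ W ((A ∘ₗ ρ g) ∘ₗ T i ∘ₗ LinearMap.adjoint (T i)) := by
    rw [h.orthProj_isotypicPart hi]
    refine trace_idempotent_compression_comp ?_ ?_ A
    · change (T i ∘ₗ LinearMap.adjoint (T i)) ∘ₗ T i ∘ₗ LinearMap.adjoint (T i) = _
      rw [LinearMap.comp_assoc, ← LinearMap.comp_assoc _ (T i), h.adjoint_comp_self hi,
        LinearMap.id_comp]
    · exact isIntertwiningMap_iff_comp_eq.1 (isIntertwiningMap_comp (h.isIntertwiningMap i)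
        (isIntertwiningMap_adjoint (h.isSchurFamily.isUnitaryRep i) h.isUnitaryRep
          (h.isIntertwiningMap i))) g
  rw [linearMap_sum_comp, map_sum, Finset.sum_congr rfl fun i hi => hterm hi, ← map_sum,
    ← linearMap_comp_sum, h.sum_comp_adjoint, LinearMap.comp_id]

theorem comp_isometryEquiv (h : IsMultFreeDecomp σ ρ s T) (hρ' : IsUnitaryRep ρ') (e : W ≃ₗᵢ[ℂ] W')
    (he : ρ.IsIntertwiningMap ρ' e.toLinearEquiv.toLinearMap) :
    IsMultFreeDecomp σ ρ' s fun i => e.toLinearEquiv.toLinearMap ∘ₗ T i where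
  isSchurFamily := h.isSchurFamily
  isUnitaryRep := hρ'
  isIntertwiningMap i := isIntertwiningMap_comp he (h.isIntertwiningMap i)
  adjoint_comp_self {i} hi := by
    rw [LinearMap.adjoint_comp, adjoint_isometryEquiv, ← h.adjoint_comp_self hi]
    ext x
    simp
  sum_comp_adjoint := by
    have hterm (i : ι) : (e.toLinearEquiv.toLinearMap ∘ₗ T i) ∘ₗ
        LinearMap.adjoint (e.toLinearEquiv.toLinearMap ∘ₗ T i) =
        e.toLinearEquiv.toLinearMap ∘ₗ (T i ∘ₗ LinearMap.adjoint (T i)) ∘ₗ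
          e.symm.toLinearEquiv.toLinearMap := by
      rw [LinearMap.adjoint_comp, adjoint_isometryEquiv]
      rfl
    rw [Finset.sum_congr rfl fun i _ => hterm i, ← linearMap_comp_sum, ← linearMap_sum_comp,
      h.sum_comp_adjoint]
    ext x
    simp

theorem comp_adjoint_self_eq_sum (h : IsMultFreeDecomp σ ρ s T) (h' : IsMultFreeDecomp σ ρ' s' T')
    {R : W' →ₗ[ℂ] W} {x : ι → ℝ} (hR : ∀ i, R ∘ₗ T' i = (x i : ℂ) • T i) :
    R ∘ₗ LinearMap.adjoint R =
      ∑ i ∈ s, ((x i ^ 2 : ℝ) : ℂ) • (T i ∘ₗ LinearMap.adjoint (T i)) := by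
  classical
  have hterm (i : ι) : R ∘ₗ (T' i ∘ₗ LinearMap.adjoint (T' i)) ∘ₗ LinearMap.adjoint R =
      ((x i ^ 2 : ℝ) : ℂ) • (T i ∘ₗ LinearMap.adjoint (T i)) := by
    rw [LinearMap.comp_assoc, ← LinearMap.adjoint_comp, ← LinearMap.comp_assoc, hR, map_smulₛₗ,
      LinearMap.smul_comp, LinearMap.comp_smul, smul_smul, Complex.conj_ofReal]
    push_cast
    rw [sq]
  calc R ∘ₗ LinearMap.adjoint R
      = ∑ i ∈ s ∪ s', R ∘ₗ (T' i ∘ₗ LinearMap.adjoint (T' i)) ∘ₗ LinearMap.adjoint R := by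
        rw [← linearMap_comp_sum, ← linearMap_sum_comp,
          h'.sum_comp_adjoint_of_subset Finset.subset_union_right, LinearMap.id_comp]
    _ = ∑ i ∈ s, ((x i ^ 2 : ℝ) : ℂ) • (T i ∘ₗ LinearMap.adjoint (T i)) := by
        rw [Finset.sum_congr rfl fun i _ => hterm i]
        exact (Finset.sum_subset Finset.subset_union_left fun i _ hi => by
          rw [h.eq_zero_of_notMem hi (h.isIntertwiningMap i), LinearMap.zero_comp, smul_zero]).symm

theorem outerTensor {H κ : Type*} [Group H]
    {Y : κ → Type*} [∀ k, NormedAddCommGroup (Y k)] [∀ k, InnerProductSpace ℂ (Y k)]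
    [∀ k, FiniteDimensional ℂ (Y k)]
    {Z : Type*} [NormedAddCommGroup Z] [InnerProductSpace ℂ Z] [FiniteDimensional ℂ Z]
    {τ : ∀ k, Representation ℂ H (Y k)} {π : Representation ℂ H Z} {t : Finset κ}
    {S : ∀ k, Y k →ₗ[ℂ] Z} (h : IsMultFreeDecomp σ ρ s T) (hS : IsMultFreeDecomp τ π t S) :
    IsMultFreeDecomp (V := fun p : ι × κ => V p.1 ⊗[ℂ] Y p.2)
      (fun p => outerTensor (σ p.1) (τ p.2)) (outerTensor ρ π) (s ×ˢ t)
      (fun p => TensorProduct.map (T p.1) (S p.2)) where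
  isSchurFamily := h.isSchurFamily.outerTensor hS.isSchurFamily
  isUnitaryRep := h.isUnitaryRep.outerTensor hS.isUnitaryRep
  isIntertwiningMap p :=
    isIntertwiningMap_outerTensor_map (h.isIntertwiningMap p.1) (hS.isIntertwiningMap p.2)
  adjoint_comp_self hp := by
    rw [TensorProduct.adjoint_map, ← TensorProduct.map_comp,
      h.adjoint_comp_self (Finset.mem_product.1 hp).1,
      hS.adjoint_comp_self (Finset.mem_product.1 hp).2, TensorProduct.map_id]
  sum_comp_adjoint := by
    simp only [TensorProduct.adjoint_map, ← TensorProduct.map_comp, Finset.sum_product]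
    have hbilin (f : ι → W →ₗ[ℂ] W) (g : κ → Z →ₗ[ℂ] Z) :
        ∑ i ∈ s, ∑ k ∈ t, TensorProduct.map (f i) (g k) =
          TensorProduct.map (∑ i ∈ s, f i) (∑ k ∈ t, g k) := by
      refine TensorProduct.ext' fun w z => ?_
      simp only [LinearMap.sum_apply, TensorProduct.map_tmul, TensorProduct.sum_tmul,
        TensorProduct.tmul_sum]
      exact Finset.sum_comm
    refine (hbilin (fun i => T i ∘ₗ LinearMap.adjoint (T i))
      (fun k => S k ∘ₗ LinearMap.adjoint (S k))).trans ?_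
    rw [h.sum_comp_adjoint, hS.sum_comp_adjoint, TensorProduct.map_id]

end IsMultFreeDecomp

end Decomposition

/-! ### The irreducible representations of `SU(2)` -/

theorem eq_of_forall_sum_mul_pow_eq {n : ℕ} {c d : Fin n → ℂ}
    (h : ∀ x : ℂ, ∑ p, c p * x ^ (p : ℕ) = ∑ p, d p * x ^ (p : ℕ)) : c = d := by
  refine sub_eq_zero.1 (Matrix.eq_zero_of_forall_index_sum_mul_pow_eq_zero
    (f := fun p : Fin n => ((p : ℕ) : ℂ)) (Nat.cast_injective.comp Fin.val_injective) fun j => ?_)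
  simp only [Pi.sub_apply, sub_mul, Finset.sum_sub_distrib, h, sub_self]

theorem natDegree_binaryForm_le {n q : ℕ} (u : Matrix (Fin 2) (Fin 2) ℂ) (hq : q ≤ n) :
    (binaryForm n u q).natDegree ≤ n :=
  (natDegree_linear_pow_mul _ _ _ _ q (n - q)).trans (Nat.add_sub_cancel' hq).le

theorem sum_coeff_binaryForm_mul_pow {n q : ℕ} (u : Matrix (Fin 2) (Fin 2) ℂ) (hq : q ≤ n)
    (x : ℂ) :
    ∑ p : Fin (n + 1), (binaryForm n u q).coeff p * x ^ (p : ℕ) =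
      (u 0 0 * x + u 1 0) ^ q * (u 0 1 * x + u 1 1) ^ (n - q) := by
  rw [Fin.sum_univ_eq_sum_range fun p => (binaryForm n u q).coeff p * x ^ p,
    ← Polynomial.eval_eq_sum_range' (Nat.lt_succ_of_le (natDegree_binaryForm_le u hq)) x]
  simp [binaryForm]

theorem sum_choose_mul_coeff_binaryForm (n : ℕ) (u : Matrix (Fin 2) (Fin 2) ℂ) (x t : ℂ) :
    ∑ q : Fin (n + 1), (∑ p : Fin (n + 1),
        (n.choose q * (binaryForm n u q).coeff p) * x ^ (p : ℕ)) * t ^ (q : ℕ) =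
      (t * (u 0 0 * x + u 1 0) + (u 0 1 * x + u 1 1)) ^ n := by
  rw [add_pow, Finset.sum_range]
  refine Finset.sum_congr rfl fun q _ => ?_
  simp_rw [mul_assoc]
  rw [← Finset.mul_sum, sum_coeff_binaryForm_mul_pow u q.is_le, mul_pow]
  ring

theorem choose_mul_coeff_binaryForm_transpose (n : ℕ) (u : Matrix (Fin 2) (Fin 2) ℂ)
    (p q : Fin (n + 1)) :
    (n.choose q : ℂ) * (binaryForm n u q).coeff p =
      n.choose p * (binaryForm n u.transpose p).coeff q := by
  revert p
  refine congrFun (eq_of_forall_sum_mul_pow_eq fun x => ?_)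
  revert q
  refine congrFun (eq_of_forall_sum_mul_pow_eq fun t => ?_)
  have hform : (t * (u 0 0 * x + u 1 0) + (u 0 1 * x + u 1 1)) ^ n =
      (x * (u.transpose 0 0 * t + u.transpose 1 0) +
        (u.transpose 0 1 * t + u.transpose 1 1)) ^ n := by
    simp only [Matrix.transpose_apply]
    ring
  rw [sum_choose_mul_coeff_binaryForm, hform, ← sum_choose_mul_coeff_binaryForm]
  simp_rw [Finset.sum_mul]
  rw [Finset.sum_comm]
  exact Finset.sum_congr rfl fun _ _ => Finset.sum_congr rfl fun _ _ => mul_right_comm _ _ _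

theorem formWeight_pos (n p : ℕ) : 0 < formWeight n p := by
  unfold formWeight; positivity

theorem choose_mul_formWeight {n p : ℕ} (hp : p ≤ n) :
    (n.choose p : ℝ) * formWeight n p = n ! := by
  rw [formWeight, ← mul_assoc]
  exact_mod_cast Nat.choose_mul_factorial_mul_factorial hp

theorem ofReal_sqrt_formWeight_ne_zero (n p : ℕ) : ((√(formWeight n p) : ℝ) : ℂ) ≠ 0 :=
  Complex.ofReal_ne_zero.2 (sqrt_formWeight_ne_zero n p)

theorem ofReal_sqrt_formWeight_sq (n p : ℕ) :
    ((√(formWeight n p) : ℝ) : ℂ) ^ 2 = (formWeight n p : ℂ) := by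
  exact_mod_cast Real.sq_sqrt (formWeight_pos n p).le

theorem formWeight_mul_coeff_binaryForm_transpose (n : ℕ) (u : Matrix (Fin 2) (Fin 2) ℂ)
    (p q : Fin (n + 1)) :
    (formWeight n p : ℂ) * (binaryForm n u q).coeff p =
      formWeight n q * (binaryForm n u.transpose p).coeff q := by
  have hcast (r : Fin (n + 1)) : (n.choose r : ℂ) * (formWeight n r : ℂ) = (n ! : ℂ) := by
    exact_mod_cast congrArg (fun x : ℝ => (x : ℂ)) (choose_mul_formWeight r.is_le)
  refine mul_left_cancel₀ (Nat.cast_ne_zero.2 n.factorial_ne_zero : (n ! : ℂ) ≠ 0) ?_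
  linear_combination
    ((formWeight n p : ℂ) * formWeight n q) * choose_mul_coeff_binaryForm_transpose n u p q
      - (formWeight n p * (binaryForm n u q).coeff p) * hcast q
      + (formWeight n q * (binaryForm n u.transpose p).coeff q) * hcast p

theorem spinMatrix_transpose (n : ℕ) (u : Matrix (Fin 2) (Fin 2) ℂ) :
    spinMatrix n u.transpose = (spinMatrix n u).transpose := by
  ext q p
  have hp := ofReal_sqrt_formWeight_ne_zero n p
  have hq := ofReal_sqrt_formWeight_ne_zero n q
  simp only [spinMatrix, Matrix.of_apply, Matrix.transpose_apply]
  push_cast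
  field_simp
  rw [ofReal_sqrt_formWeight_sq, ofReal_sqrt_formWeight_sq,
    formWeight_mul_coeff_binaryForm_transpose, Matrix.transpose_transpose]

theorem spinMatrix_map_conj (n : ℕ) (u : Matrix (Fin 2) (Fin 2) ℂ) :
    spinMatrix n (u.map (starRingEnd ℂ)) = (spinMatrix n u).map (starRingEnd ℂ) := by
  ext p q
  have h : binaryForm n (u.map (starRingEnd ℂ)) q = (binaryForm n u q).map (starRingEnd ℂ) := by
    simp [binaryForm]
  simp [spinMatrix, h]

theorem spinMatrix_conjTranspose (n : ℕ) (u : Matrix (Fin 2) (Fin 2) ℂ) :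
    spinMatrix n u.conjTranspose = (spinMatrix n u).conjTranspose := by
  have h : u.conjTranspose = (u.map (starRingEnd ℂ)).transpose := by ext; simp
  rw [h, spinMatrix_transpose, spinMatrix_map_conj]
  ext; simp

theorem spinRep_apply (n : ℕ) (u : SU2) : spinRep n u = Matrix.toEuclideanLin (spinMatrix n u.1) :=
  rfl

theorem isUnitaryRep_spinRep (n : ℕ) : IsUnitaryRep (spinRep n) := fun u => by
  rw [spinRep_apply, spinRep_apply, ← Matrix.toEuclideanLin_conjTranspose_eq_adjoint,
    ← spinMatrix_conjTranspose]
  rfl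

/-- The element `diag(z, z̄)` of the maximal torus of `SU(2)`, used to read off weights. -/
def torusElement (z : ℂ) (hz : ‖z‖ = 1) : SU2 :=
  ⟨!![z, 0; 0, starRingEnd ℂ z], by
    have h : z * starRingEnd ℂ z = 1 := by rw [Complex.mul_conj']; simp [hz]
    rw [Matrix.mem_specialUnitaryGroup_iff, Matrix.mem_unitaryGroup_iff]
    refine ⟨?_, by simp [Matrix.det_fin_two, h]⟩
    ext i j
    fin_cases i <;> fin_cases j <;>
      simp [Matrix.mul_apply, Fin.sum_univ_two, Matrix.star_apply, h, mul_comm _ z]⟩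

/-- A rotation in `SU(2)` all of whose entries are nonzero, so that its spin matrices have no zero
in their first column.  The cosine `3/5` and sine `4/5` make it rational. -/
def rotationElement : SU2 :=
  ⟨!![3 / 5, -4 / 5; 4 / 5, 3 / 5], by
    rw [Matrix.mem_specialUnitaryGroup_iff, Matrix.mem_unitaryGroup_iff]
    refine ⟨?_, by rw [Matrix.det_fin_two]; norm_num⟩
    ext i j
    fin_cases i <;> fin_cases j <;>
      norm_num [Matrix.mul_apply, Fin.sum_univ_two, Matrix.star_apply, map_ofNat]⟩

theorem spinMatrix_diagonal (n : ℕ) (z z' : ℂ) :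
    spinMatrix n !![z, 0; 0, z'] =
      Matrix.diagonal fun p : Fin (n + 1) => z ^ (p : ℕ) * z' ^ (n - (p : ℕ)) := by
  ext p q
  have h : binaryForm n !![z, 0; 0, z'] q = C (z ^ (q : ℕ) * z' ^ (n - q)) * X ^ (q : ℕ) := by
    simp [binaryForm, mul_pow]; ring
  simp only [spinMatrix, Matrix.of_apply, h, Polynomial.coeff_C_mul, Polynomial.coeff_X_pow]
  rcases eq_or_ne p q with rfl | hpq
  · simp [sqrt_formWeight_ne_zero n p]
  · simp [hpq, Fin.val_ne_of_ne hpq]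

theorem coeff_binaryForm_zero (n : ℕ) (u : Matrix (Fin 2) (Fin 2) ℂ) (p : ℕ) :
    (binaryForm n u 0).coeff p = u 0 1 ^ p * u 1 1 ^ (n - p) * n.choose p := by
  have h : binaryForm n u 0 = ((X + C (u 1 1)) ^ n).comp (C (u 0 1) * X) := by simp [binaryForm]
  rw [h, Polynomial.comp_C_mul_X_coeff, Polynomial.coeff_X_add_C_pow]
  ring

theorem spinMatrix_apply_zero_ne_zero {n : ℕ} {u : Matrix (Fin 2) (Fin 2) ℂ} (h01 : u 0 1 ≠ 0)
    (h11 : u 1 1 ≠ 0) (p : Fin (n + 1)) : spinMatrix n u p 0 ≠ 0 := by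
  simp only [spinMatrix, Matrix.of_apply, Fin.val_zero, coeff_binaryForm_zero, Complex.ofReal_div]
  exact mul_ne_zero
    (div_ne_zero (ofReal_sqrt_formWeight_ne_zero n p) (ofReal_sqrt_formWeight_ne_zero n 0))
    (mul_ne_zero (mul_ne_zero (pow_ne_zero _ h01) (pow_ne_zero _ h11))
      (Nat.cast_ne_zero.2 (Nat.choose_pos p.is_le).ne'))

theorem spinMatrix_rotationElement_apply_zero_ne_zero (n : ℕ) (p : Fin (n + 1)) :
    spinMatrix n rotationElement.1 p 0 ≠ 0 :=
  spinMatrix_apply_zero_ne_zero (by simp [rotationElement]) (by simp [rotationElement]) p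

theorem pow_mul_pow_sub_mul_pow {R : Type*} [CommRing R] {z z' : R} (h : z * z' = 1) {r m : ℕ}
    (hr : r ≤ m) : z ^ r * z' ^ (m - r) * z ^ m = z ^ (2 * r) := by
  obtain ⟨s, rfl⟩ := Nat.exists_eq_add_of_le hr
  calc z ^ r * z' ^ (r + s - r) * z ^ (r + s) = z ^ (2 * r) * (z * z') ^ s := by
        rw [Nat.add_sub_cancel_left]; ring
    _ = z ^ (2 * r) := by rw [h, one_pow, mul_one]

section Schur

variable {k c : ℕ} {M : Matrix (Fin (c + 1)) (Fin (k + 1)) ℂ}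

-- Evaluating at a torus element of order `2 (k + c) + 1` separates all weights that occur.
theorem weight_eq_of_intertwines (hM : ∀ u : SU2, M * spinMatrix k u.1 = spinMatrix c u.1 * M)
    {p : Fin (c + 1)} {q : Fin (k + 1)} (h : M p q ≠ 0) : 2 * (p : ℕ) + k = 2 * q + c := by
  have hN : 2 * (k + c) + 1 ≠ 0 := by omega
  have hζ := Complex.isPrimitiveRoot_exp _ hN
  set z := Complex.exp (2 * Real.pi * Complex.I / ((2 * (k + c) + 1 : ℕ) : ℂ))
  have hz : ‖z‖ = 1 := hζ.norm'_eq_one hN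
  have hzz : z * starRingEnd ℂ z = 1 := by rw [Complex.mul_conj']; simp [hz]
  have hweight : z ^ (q : ℕ) * starRingEnd ℂ z ^ (k - (q : ℕ)) =
      z ^ (p : ℕ) * starRingEnd ℂ z ^ (c - (p : ℕ)) := by
    have hpq := congrFun (congrFun (hM (torusElement z hz)) p) q
    simp only [torusElement, spinMatrix_diagonal, Matrix.mul_diagonal, Matrix.diagonal_mul] at hpq
    exact mul_right_cancel₀ h ((mul_comm _ _).trans hpq)
  have hpow : z ^ (2 * (p : ℕ) + k) = z ^ (2 * (q : ℕ) + c) := by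
    rw [pow_add, pow_add, ← pow_mul_pow_sub_mul_pow hzz p.is_le,
      ← pow_mul_pow_sub_mul_pow hzz q.is_le, hweight]
    ring
  exact hζ.pow_inj (by omega) (by omega) hpow

theorem apply_mul_spinMatrix_apply_zero
    (hM : ∀ u : SU2, M * spinMatrix k u.1 = spinMatrix c u.1 * M) {p : Fin (c + 1)}
    {q : Fin (k + 1)} (hpq : 2 * (p : ℕ) + k = 2 * q + c) (u : SU2) :
    M p q * spinMatrix k u.1 q 0 = ∑ r, spinMatrix c u.1 p r * M r 0 := by
  rw [← Matrix.mul_apply, ← hM, Matrix.mul_apply, Finset.sum_eq_single q _ (by simp)]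
  intro r _ hr
  by_contra h
  have := weight_eq_of_intertwines hM (left_ne_zero_of_mul h)
  exact hr (Fin.ext (by omega))

theorem eq_zero_of_intertwines_of_lt
    (hM : ∀ u : SU2, M * spinMatrix k u.1 = spinMatrix c u.1 * M) (hck : c < k) : M = 0 := by
  ext p q
  by_contra h
  have hcol (r : Fin (c + 1)) : M r 0 = 0 := by
    by_contra h
    have := weight_eq_of_intertwines hM h
    simp only [Fin.val_zero] at this
    omega
  have hprod := apply_mul_spinMatrix_apply_zero hM (weight_eq_of_intertwines hM h) rotationElement
  simp only [hcol, mul_zero, Finset.sum_const_zero] at hprod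
  exact mul_ne_zero h (spinMatrix_rotationElement_apply_zero_ne_zero k q) hprod

theorem eq_smul_one_of_intertwines {M : Matrix (Fin (c + 1)) (Fin (c + 1)) ℂ}
    (hM : ∀ u : SU2, M * spinMatrix c u.1 = spinMatrix c u.1 * M) : M = M 0 0 • 1 := by
  have hdiag (p q : Fin (c + 1)) (hpq : p ≠ q) : M p q = 0 := by
    by_contra h
    have := weight_eq_of_intertwines hM h
    exact hpq (Fin.ext (by omega))
  ext p q
  rcases eq_or_ne p q with rfl | hpq
  · have hprod := apply_mul_spinMatrix_apply_zero hM rfl rotationElement (p := p) (q := p)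
    rw [Finset.sum_eq_single 0 (fun r _ hr => by rw [hdiag r 0 hr, mul_zero]) (by simp),
      mul_comm] at hprod
    simpa using
      mul_left_cancel₀ (spinMatrix_rotationElement_apply_zero_ne_zero c p) hprod
  · simp [hdiag p q hpq, hpq]

theorem toEuclideanLin_symm_intertwines {A : SpinSpace k →ₗ[ℂ] SpinSpace c}
    (hA : (spinRep k).IsIntertwiningMap (spinRep c) A) (u : SU2) :
    Matrix.toEuclideanLin.symm A * spinMatrix k u.1 =
      spinMatrix c u.1 * Matrix.toEuclideanLin.symm A := by
  apply Matrix.toEuclideanLin.injective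
  rw [Matrix.toLpLin_mul 2 2 2, Matrix.toLpLin_mul 2 2 2, LinearEquiv.apply_symm_apply]
  exact isIntertwiningMap_iff_comp_eq.1 hA u

theorem eq_zero_of_isIntertwiningMap_spinRep_of_lt {A : SpinSpace k →ₗ[ℂ] SpinSpace c}
    (hA : (spinRep k).IsIntertwiningMap (spinRep c) A) (hck : c < k) : A = 0 :=
  (LinearEquiv.map_eq_zero_iff _).1
    (eq_zero_of_intertwines_of_lt (toEuclideanLin_symm_intertwines hA) hck)

end Schur

theorem isSchurFamily_spinRep : IsSchurFamily spinRep where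
  isUnitaryRep := isUnitaryRep_spinRep
  eq_zero {k c} hkc A hA := by
    rcases lt_or_gt_of_ne hkc with h | h
    · exact (LinearEquiv.map_eq_zero_iff LinearMap.adjoint).1 <|
        eq_zero_of_isIntertwiningMap_spinRep_of_lt
          (isIntertwiningMap_adjoint (isUnitaryRep_spinRep k) (isUnitaryRep_spinRep c) hA) h
    · exact eq_zero_of_isIntertwiningMap_spinRep_of_lt hA h
  exists_eq_smul_id {c A} hA := by
    refine ⟨Matrix.toEuclideanLin.symm A 0 0, ?_⟩
    have h := (LinearEquiv.symm_apply_eq _).1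
      (eq_smul_one_of_intertwines (toEuclideanLin_symm_intertwines hA))
    rwa [map_smul, Matrix.toLpLin_one] at h

/-! ### The `3j` symbols as coefficients of an invariant form -/

theorem sum_sum_sum_comm {ι₁ ι₂ ι₃ κ₁ κ₂ κ₃ M : Type*} [AddCommMonoid M] (s₁ : Finset ι₁)
    (s₂ : Finset ι₂) (s₃ : Finset ι₃) (t₁ : Finset κ₁) (t₂ : Finset κ₂) (t₃ : Finset κ₃)
    (f : ι₁ → ι₂ → ι₃ → κ₁ → κ₂ → κ₃ → M) :
    ∑ i ∈ s₁, ∑ j ∈ s₂, ∑ k ∈ s₃, ∑ i' ∈ t₁, ∑ j' ∈ t₂, ∑ k' ∈ t₃, f i j k i' j' k' =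
      ∑ i' ∈ t₁, ∑ j' ∈ t₂, ∑ k' ∈ t₃, ∑ i ∈ s₁, ∑ j ∈ s₂, ∑ k ∈ s₃, f i j k i' j' k' := by
  have h := Finset.sum_comm (s := s₁ ×ˢ s₂ ×ˢ s₃) (t := t₁ ×ˢ t₂ ×ˢ t₃)
    (f := fun x y => f x.1 x.2.1 x.2.2 y.1 y.2.1 y.2.2)
  simpa only [Finset.sum_product] using h

theorem sum_mul_sum_mul_sum {ι κ ν R : Type*} [NonUnitalNonAssocSemiring R] (s : Finset ι)
    (t : Finset κ) (w : Finset ν) (f : ι → R) (g : κ → R) (h : ν → R) :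
    (∑ i ∈ s, f i) * (∑ j ∈ t, g j) * (∑ k ∈ w, h k) =
      ∑ i ∈ s, ∑ j ∈ t, ∑ k ∈ w, f i * g j * h k := by
  rw [Finset.sum_mul_sum]
  simp only [Finset.sum_mul]
  simp only [Finset.mul_sum]

theorem sum_fin_ite_mul {R : Type*} [NonUnitalNonAssocSemiring R] {l m n a b c : ℕ} (ha : a < l)
    (hb : b < m) (hc : c < n) (t : R) (f : ℕ → ℕ → ℕ → R) :
    ∑ p : Fin l, ∑ q : Fin m, ∑ r : Fin n,
      (if a = p ∧ b = q ∧ c = r then t else 0) * f p q r = t * f a b c := by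
  lift a to Fin l using ha
  lift b to Fin m using hb
  lift c to Fin n using hc
  simp [ite_and, Fin.val_inj]

theorem sub_pow_eq_sum {R : Type*} [CommRing R] (a b : R) (n : ℕ) :
    (a - b) ^ n =
      ∑ i ∈ Finset.range (n + 1), (-1) ^ i * (n.choose i : R) * (b ^ i * a ^ (n - i)) := by
  rw [sub_eq_neg_add, add_pow]
  refine Finset.sum_congr rfl fun i _ => ?_
  rw [neg_pow]
  ring

/-- The coefficient of `x₁^p y₁^(α+γ-p) x₂^q y₂^(α+β-q) x₃^r y₃^(β+γ-r)` in
`(x₁y₂ - x₂y₁)^α (x₂y₃ - x₃y₂)^β (x₃y₁ - x₁y₃)^γ`, the form on three copies of `ℂ²` that is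
invariant under `SL(2, ℂ)`; up to normalisation this is a `3j` symbol (`threeJ_eq`). -/
def invariantCoeff (α β γ p q r : ℕ) : ℝ :=
  ∑ i ∈ Finset.range (α + 1), ∑ j ∈ Finset.range (β + 1), ∑ l ∈ Finset.range (γ + 1),
    if α - i + l = p ∧ i + (β - j) = q ∧ j + (γ - l) = r then
      (-1) ^ (i + j + l) * (α.choose i * β.choose j * γ.choose l : ℝ) else 0

theorem monomial_invariantForm {R : Type*} [CommSemiring R] {α β γ i j l : ℕ} (hi : i ≤ α)
    (hj : j ≤ β) (hl : l ≤ γ) (x₁ y₁ x₂ y₂ x₃ y₃ : R) :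
    (x₁ ^ (α - i + l) * y₁ ^ (α + γ - (α - i + l))) *
        (x₂ ^ (i + (β - j)) * y₂ ^ (α + β - (i + (β - j)))) *
          (x₃ ^ (j + (γ - l)) * y₃ ^ (β + γ - (j + (γ - l)))) =
      ((x₂ * y₁) ^ i * (x₁ * y₂) ^ (α - i)) * ((x₃ * y₂) ^ j * (x₂ * y₃) ^ (β - j)) *
        ((x₁ * y₃) ^ l * (x₃ * y₁) ^ (γ - l)) := by
  rw [show α + γ - (α - i + l) = i + (γ - l) by omega,
    show α + β - (i + (β - j)) = α - i + j by omega,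
    show β + γ - (j + (γ - l)) = β - j + l by omega]
  ring

theorem sum_invariantCoeff_mul (α β γ : ℕ) (x₁ y₁ x₂ y₂ x₃ y₃ : ℂ) :
    ∑ p : Fin (α + γ + 1), ∑ q : Fin (α + β + 1), ∑ r : Fin (β + γ + 1),
      (invariantCoeff α β γ p q r : ℂ) *
        ((x₁ ^ (p : ℕ) * y₁ ^ (α + γ - p)) * (x₂ ^ (q : ℕ) * y₂ ^ (α + β - q)) *
          (x₃ ^ (r : ℕ) * y₃ ^ (β + γ - r))) =
      (x₁ * y₂ - x₂ * y₁) ^ α * (x₂ * y₃ - x₃ * y₂) ^ β * (x₃ * y₁ - x₁ * y₃) ^ γ := by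
  simp only [invariantCoeff, Complex.ofReal_sum, apply_ite Complex.ofReal, Complex.ofReal_zero,
    Finset.sum_mul]
  rw [sum_sum_sum_comm, sub_pow_eq_sum, sub_pow_eq_sum, sub_pow_eq_sum, sum_mul_sum_mul_sum]
  refine Finset.sum_congr rfl fun i hi => Finset.sum_congr rfl fun j hj =>
    Finset.sum_congr rfl fun l hl => ?_
  have hi' := Finset.mem_range_succ_iff.1 hi
  have hj' := Finset.mem_range_succ_iff.1 hj
  have hl' := Finset.mem_range_succ_iff.1 hl
  rw [sum_fin_ite_mul (by omega) (by omega) (by omega) _ fun p q r =>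
      (x₁ ^ p * y₁ ^ (α + γ - p)) * (x₂ ^ q * y₂ ^ (α + β - q)) * (x₃ ^ r * y₃ ^ (β + γ - r)),
    monomial_invariantForm hi' hj' hl']
  push_cast
  ring

theorem eq_of_forall_sum_mul_pow_mul_pow_mul_pow_eq {l m n : ℕ}
    {f g : Fin l → Fin m → Fin n → ℂ}
    (h : ∀ x y z : ℂ, ∑ p, ∑ q, ∑ r, f p q r * (x ^ (p : ℕ) * y ^ (q : ℕ) * z ^ (r : ℕ)) =
      ∑ p, ∑ q, ∑ r, g p q r * (x ^ (p : ℕ) * y ^ (q : ℕ) * z ^ (r : ℕ))) : f = g := by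
  have horner (F : Fin l → Fin m → Fin n → ℂ) (x y z : ℂ) :
      ∑ p, ∑ q, ∑ r, F p q r * (x ^ (p : ℕ) * y ^ (q : ℕ) * z ^ (r : ℕ)) =
        ∑ p, (∑ q, (∑ r, F p q r * z ^ (r : ℕ)) * y ^ (q : ℕ)) * x ^ (p : ℕ) := by
    simp only [Finset.sum_mul]
    refine Finset.sum_congr rfl fun _ _ => Finset.sum_congr rfl fun _ _ =>
      Finset.sum_congr rfl fun _ _ => ?_
    ring
  simp only [horner] at h
  funext p q
  refine eq_of_forall_sum_mul_pow_eq fun z => ?_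
  have h_q (y : ℂ) := congrFun (eq_of_forall_sum_mul_pow_eq fun x => h x y z) p
  exact congrFun (eq_of_forall_sum_mul_pow_eq h_q) q

theorem sum_invariantCoeff_mul_coeff_binaryForm (α β γ : ℕ) {u : Matrix (Fin 2) (Fin 2) ℂ}
    (hu : u.det = 1) (p' : Fin (α + γ + 1)) (q' : Fin (α + β + 1)) (r' : Fin (β + γ + 1)) :
    ∑ p : Fin (α + γ + 1), ∑ q : Fin (α + β + 1), ∑ r : Fin (β + γ + 1),
      (invariantCoeff α β γ p q r : ℂ) * ((binaryForm (α + γ) u p).coeff p' *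
        (binaryForm (α + β) u q).coeff q' * (binaryForm (β + γ) u r).coeff r') =
      invariantCoeff α β γ p' q' r' := by
  revert p' q' r'
  simp only [← funext_iff]
  refine eq_of_forall_sum_mul_pow_mul_pow_mul_pow_eq fun x y z => ?_
  have hdet (s t : ℂ) : (u 0 0 * s + u 1 0) * (u 0 1 * t + u 1 1) -
      (u 0 0 * t + u 1 0) * (u 0 1 * s + u 1 1) = s * 1 - t * 1 := by
    rw [Matrix.det_fin_two] at hu
    linear_combination (s - t) * hu
  have h₁ := sum_invariantCoeff_mul α β γ x 1 y 1 z 1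
  have h₂ := sum_invariantCoeff_mul α β γ (u 0 0 * x + u 1 0) (u 0 1 * x + u 1 1)
    (u 0 0 * y + u 1 0) (u 0 1 * y + u 1 1) (u 0 0 * z + u 1 0) (u 0 1 * z + u 1 1)
  rw [hdet, hdet, hdet, ← h₁] at h₂
  simp only [one_pow, mul_one] at h₂
  rw [← h₂]
  simp only [Finset.sum_mul]
  rw [sum_sum_sum_comm]
  refine Finset.sum_congr rfl fun p _ => Finset.sum_congr rfl fun q _ =>
    Finset.sum_congr rfl fun r _ => ?_
  rw [← sum_coeff_binaryForm_mul_pow u p.is_le x, ← sum_coeff_binaryForm_mul_pow u q.is_le y,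
    ← sum_coeff_binaryForm_mul_pow u r.is_le z, sum_mul_sum_mul_sum]
  simp only [Finset.mul_sum]
  refine Finset.sum_congr rfl fun _ _ => Finset.sum_congr rfl fun _ _ =>
    Finset.sum_congr rfl fun _ _ => ?_
  ring

theorem invariantCoeff_eq_zero {α β γ p q r : ℕ} (h : p + q + r ≠ α + β + γ) :
    invariantCoeff α β γ p q r = 0 := by
  refine Finset.sum_eq_zero fun i hi => Finset.sum_eq_zero fun j hj =>
    Finset.sum_eq_zero fun l hl => if_neg ?_
  rw [Finset.mem_range] at hi hj hl
  omega

theorem cast_choose_eq_div {m i j : ℕ} (h : i + j = m) :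
    (m.choose i : ℝ) = m ! / (i ! * j !) := by
  subst h
  exact Nat.cast_add_choose ℝ

theorem sum_sum_ite_eq_ite {M : Type*} [AddCommMonoid M] {α β γ p q r i : ℕ}
    (h : p + q + r = α + β + γ) (hp : p ≤ α + γ) (hq : q ≤ α + β) (hi : i ≤ α)
    (f : ℕ → ℕ → M) :
    (∑ j ∈ Finset.range (β + 1), ∑ l ∈ Finset.range (γ + 1),
      if α - i + l = p ∧ i + (β - j) = q ∧ j + (γ - l) = r then f j l else 0) =
      if i ≤ α ∧ i ≤ α + γ - p ∧ i ≤ q ∧ α ≤ p + i ∧ α ≤ α + β - q + i then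
        f (α + β - q + i - α) (p + i - α) else 0 := by
  split_ifs with hc
  · rw [Finset.sum_eq_single_of_mem (α + β - q + i - α) (Finset.mem_range.2 (by omega)),
      Finset.sum_eq_single_of_mem (p + i - α) (Finset.mem_range.2 (by omega)),
      if_pos (by omega)]
    · exact fun l hl hne => if_neg (by rw [Finset.mem_range] at hl; omega)
    · intro j hj hne
      rw [Finset.mem_range] at hj
      exact Finset.sum_eq_zero fun l hl => if_neg (by rw [Finset.mem_range] at hl; omega)
  · refine Finset.sum_eq_zero fun j hj => Finset.sum_eq_zero fun l hl => if_neg ?_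
    rw [Finset.mem_range] at hj hl
    omega

theorem neg_one_pow_mul_choose_mul_choose_mul_choose {α β γ p q r i j l : ℕ}
    (hl : p + i = α + l) (hj : i + β = q + j) (hr : r = j + (γ - l)) (hi : i ≤ α) (hiq : i ≤ q)
    (hlγ : l ≤ γ) :
    (-1) ^ (i + j + l) * (α.choose i * β.choose j * γ.choose l : ℝ) =
      (α ! * β ! * γ ! : ℝ) * ((-1 : ℝ) ^ ((γ : ℤ) - r) * ((-1 : ℝ) ^ i /
        (i ! * (α - i)! * (α + γ - p - i)! * (q - i)! * l ! * j ! : ℝ))) := by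
  have hsign : (-1 : ℝ) ^ ((γ : ℤ) - r) = (-1) ^ (j + l) := by
    have : (γ : ℤ) - r = ((j + l : ℕ) : ℤ) + 2 * (-(j : ℤ)) := by push_cast; omega
    rw [this, zpow_add₀ (by norm_num), zpow_natCast, zpow_mul]
    norm_num
  rw [hsign, cast_choose_eq_div (i := i) (j := α - i) (by omega),
    cast_choose_eq_div (i := j) (j := q - i) (by omega),
    cast_choose_eq_div (i := l) (j := α + γ - p - i) (by omega),
    show i + j + l = (j + l) + i by ring, pow_add]
  field_simp

theorem invariantCoeff_eq_sum {α β γ p q r : ℕ} (h : p + q + r = α + β + γ) (hp : p ≤ α + γ)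
    (hq : q ≤ α + β) :
    invariantCoeff α β γ p q r = (α ! * β ! * γ ! : ℝ) * ((-1 : ℝ) ^ ((γ : ℤ) - r) *
      ∑ s ∈ (Finset.range (α + β + γ + 1)).filter (fun s =>
          s ≤ α ∧ s ≤ α + γ - p ∧ s ≤ q ∧ α ≤ p + s ∧ α ≤ α + β - q + s),
        (-1 : ℝ) ^ s / ((s)! * (α - s)! * (α + γ - p - s)! * (q - s)! *
          (p + s - α)! * (α + β - q + s - α)! : ℝ)) := by
  have hf : (Finset.range (α + β + γ + 1)).filter (fun s =>
      s ≤ α ∧ s ≤ α + γ - p ∧ s ≤ q ∧ α ≤ p + s ∧ α ≤ α + β - q + s) =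
      (Finset.range (α + 1)).filter (fun s =>
        s ≤ α ∧ s ≤ α + γ - p ∧ s ≤ q ∧ α ≤ p + s ∧ α ≤ α + β - q + s) := by
    ext s
    simp only [Finset.mem_filter, Finset.mem_range]
    omega
  rw [hf, Finset.sum_filter, Finset.mul_sum, Finset.mul_sum, invariantCoeff]
  refine Finset.sum_congr rfl fun i hi => ?_
  rw [sum_sum_ite_eq_ite h hp hq (Finset.mem_range_succ_iff.1 hi) fun j l =>
    (-1) ^ (i + j + l) * (α.choose i * β.choose j * γ.choose l : ℝ)]
  split_ifs with hc
  · exact neg_one_pow_mul_choose_mul_choose_mul_choose (by omega) (by omega) (by omega) (by omega)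
      (by omega) (by omega)
  · simp only [mul_zero]

/-- The factor between the `3j` symbol and the normalised coefficient of the invariant form. -/
def threeJNorm (α β γ : ℕ) : ℝ :=
  √((α ! * γ ! * β ! : ℝ) / ((α + β + γ + 1)! : ℝ)) / (α ! * β ! * γ !)

theorem threeJNorm_sq (α β γ : ℕ) :
    threeJNorm α β γ ^ 2 * (α ! * β ! * γ ! * (α + β + γ + 1)!) = 1 := by
  rw [threeJNorm, div_pow, Real.sq_sqrt (by positivity)]
  field_simp

theorem triangle_iff {a b c : ℕ} :
    Triangle a b c ↔ ∃ α β γ, a = α + γ ∧ b = α + β ∧ c = β + γ := by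
  constructor
  · rintro ⟨⟨S, hS⟩, h₁, h₂, h₃⟩
    exact ⟨S - c, S - a, S - b, by omega, by omega, by omega⟩
  · rintro ⟨α, β, γ, rfl, rfl, rfl⟩
    exact ⟨⟨α + β + γ, by ring⟩, by omega, by omega, by omega⟩

theorem threeJ_eq (α β γ : ℕ) (p : Fin (α + γ + 1)) (q : Fin (α + β + 1)) (r : Fin (β + γ + 1)) :
    threeJ (α + γ) (α + β) (β + γ) p q r = threeJNorm α β γ *
      (√(formWeight (α + γ) p) * √(formWeight (α + β) q) * √(formWeight (β + γ) r)) *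
        invariantCoeff α β γ p q r := by
  unfold threeJ
  split_ifs with h
  · have hS : (α + γ + (α + β) + (β + γ)) / 2 = α + β + γ := by omega
    have hα : α + β + γ - (β + γ) = α := by omega
    have hγ : α + β + γ - (α + β) = γ := by omega
    have hβ : α + β + γ - (α + γ) = β := by omega
    have hsign : ((α + β + γ : ℕ) : ℤ) - ((α + β : ℕ) : ℤ) - ((r : ℕ) : ℤ) = γ - (r : ℕ) := by
      push_cast; ring
    rw [invariantCoeff_eq_sum (by omega) p.is_le q.is_le,
      ← Real.sqrt_mul (formWeight_pos _ _).le,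
      ← Real.sqrt_mul (mul_pos (formWeight_pos _ _) (formWeight_pos _ _)).le]
    simp only [hS, hα, hβ, hγ, hsign, threeJNorm, formWeight]
    field_simp
  · rw [invariantCoeff_eq_zero, mul_zero]
    exact fun h' => h ⟨triangle_iff.2 ⟨α, β, γ, rfl, rfl, rfl⟩, by omega⟩

theorem threeJ_eq_zero {a b c : ℕ} (h : ¬ Triangle a b c) (p : Fin (a + 1)) (q : Fin (b + 1))
    (r : Fin (c + 1)) : threeJ a b c p q r = 0 := by
  rw [threeJ, if_neg fun hT => h hT.1]

theorem sum_spinMatrix_mul_threeJ (a b c : ℕ) {u : Matrix (Fin 2) (Fin 2) ℂ} (hu : u.det = 1)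
    (p' : Fin (a + 1)) (q' : Fin (b + 1)) (r' : Fin (c + 1)) :
    ∑ p, ∑ q, ∑ r, spinMatrix a u p' p * spinMatrix b u q' q * spinMatrix c u r' r *
      (threeJ a b c p q r : ℂ) = threeJ a b c p' q' r' := by
  by_cases h : Triangle a b c
  · obtain ⟨α, β, γ, rfl, rfl, rfl⟩ := triangle_iff.1 h
    rw [threeJ_eq]
    push_cast
    rw [← sum_invariantCoeff_mul_coeff_binaryForm α β γ hu p' q' r']
    simp_rw [Finset.mul_sum]
    refine Finset.sum_congr rfl fun p _ => Finset.sum_congr rfl fun q _ =>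
      Finset.sum_congr rfl fun r _ => ?_
    have hp := ofReal_sqrt_formWeight_ne_zero (α + γ) p
    have hq := ofReal_sqrt_formWeight_ne_zero (α + β) q
    have hr := ofReal_sqrt_formWeight_ne_zero (β + γ) r
    simp only [threeJ_eq, spinMatrix, Matrix.of_apply]
    push_cast
    field_simp
  · simp [threeJ_eq_zero h]

theorem sum_antidiagonal_add_choose_mul (m n k : ℕ) :
    ∑ x ∈ Finset.HasAntidiagonal.antidiagonal k, (m + x.1).choose m * (n + x.2).choose n =
      (m + n + 1 + k).choose (m + n + 1) := by
  have h := congrArg Units.val (PowerSeries.invOneSubPow_add ℤ (m + 1) (n + 1))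
  rw [Units.val_mul, show m + 1 + (n + 1) = m + n + 1 + 1 by ring] at h
  simp only [PowerSeries.invOneSubPow_val_succ_eq_mk_add_choose] at h
  have hk := congrArg (PowerSeries.coeff k) h
  simp only [PowerSeries.coeff_mul, PowerSeries.coeff_mk] at hk
  exact_mod_cast hk.symm

theorem invariantCoeff_last (α β γ p q : ℕ) :
    invariantCoeff α β γ p q (β + γ) =
      if p + q = α then (-1) ^ (q + β) * (α.choose q : ℝ) else 0 := by
  split_ifs with h
  · rw [invariantCoeff, Finset.sum_eq_single_of_mem q (Finset.mem_range.2 (by omega))]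
    · rw [sum_sum_ite_eq_ite (by omega) (by omega) (by omega) (by omega), if_pos (by omega),
        show α + β - q + q - α = β by omega, show p + q - α = 0 by omega]
      simp
    · intro i hi hne
      rw [Finset.mem_range] at hi
      refine Finset.sum_eq_zero fun j hj => Finset.sum_eq_zero fun l hl => if_neg ?_
      rw [Finset.mem_range] at hj hl
      omega
  · exact invariantCoeff_eq_zero (by omega)

theorem sum_fin_sum_fin_eq_sum_antidiagonal {M : Type*} [AddCommMonoid M] {k l m : ℕ} (hl : k ≤ l)
    (hm : k ≤ m) {f : ℕ → ℕ → M} (hf : ∀ p q, p + q ≠ k → f p q = 0) :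
    ∑ p : Fin (l + 1), ∑ q : Fin (m + 1), f p q =
      ∑ x ∈ Finset.HasAntidiagonal.antidiagonal k, f x.1 x.2 := by
  simp only [← Finset.sum_range]
  rw [← Finset.sum_range fun p => ∑ q ∈ Finset.range (m + 1), f p q]
  rw [← Finset.sum_product']
  refine (Finset.sum_subset ?_ ?_).symm
  · rintro ⟨p, q⟩ h
    simp only [Finset.HasAntidiagonal.mem_antidiagonal, Finset.mem_product, Finset.mem_range] at h ⊢
    omega
  · rintro ⟨p, q⟩ _ h
    exact hf p q (by simpa using h)

theorem weighted_invariantCoeff_last_sq {α p q : ℕ} (β γ : ℕ) (h : p + q = α) :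
    formWeight (α + γ) p * formWeight (α + β) q * formWeight (β + γ) (β + γ) *
        invariantCoeff α β γ p q (β + γ) ^ 2 =
      ((β + γ)! * (α !) ^ 2 * β ! * γ !) * (((β + p).choose β * (γ + q).choose γ : ℕ) : ℝ) := by
  have hsign : ((-1 : ℝ) ^ (q + β)) ^ 2 = 1 := by rw [← pow_mul, mul_comm, pow_mul]; simp
  rw [invariantCoeff_last, if_pos h, mul_pow, hsign, Nat.cast_mul,
    cast_choose_eq_div (i := q) (j := p) (m := α) (by omega),
    cast_choose_eq_div (i := β) (j := p) rfl, cast_choose_eq_div (i := γ) (j := q) rfl]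
  simp only [formWeight, show α + γ - p = γ + q by omega, show α + β - q = β + p by omega,
    Nat.sub_self, Nat.factorial_zero, Nat.cast_one]
  field_simp

theorem sum_threeJ_last_sq {a b c : ℕ} (h : Triangle a b c) :
    ∑ p, ∑ q, threeJ a b c p q (Fin.last c) ^ 2 = 1 / (c + 1 : ℝ) := by
  obtain ⟨α, β, γ, rfl, rfl, rfl⟩ := triangle_iff.1 h
  simp_rw [threeJ_eq, mul_pow, Real.sq_sqrt (formWeight_pos _ _).le, Fin.val_last, mul_assoc,
    ← Finset.mul_sum (a := threeJNorm α β γ ^ 2), ← mul_assoc]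
  rw [sum_fin_sum_fin_eq_sum_antidiagonal (k := α) (by omega) (by omega)
    (f := fun p q => formWeight (α + γ) p * formWeight (α + β) q *
      formWeight (β + γ) (β + γ) * invariantCoeff α β γ p q (β + γ) ^ 2)
    fun p q hpq => by simp [invariantCoeff_last, hpq]]
  rw [Finset.sum_congr rfl fun x hx =>
      weighted_invariantCoeff_last_sq β γ (Finset.HasAntidiagonal.mem_antidiagonal.1 hx),
    ← Finset.mul_sum, ← Nat.cast_sum, sum_antidiagonal_add_choose_mul,
    cast_choose_eq_div (i := β + γ + 1) (j := α) rfl]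
  have hnorm := threeJNorm_sq α β γ
  rw [show β + γ + 1 + α = α + β + γ + 1 by ring, Nat.factorial_succ (β + γ)]
  push_cast
  field_simp
  field_simp at hnorm
  linear_combination hnorm

/-! ### The Clebsch-Gordan decomposition -/

section ClebschGordan

open scoped Kronecker

variable (a b c : ℕ)

/-- The element `w = exp(-iπσ_y/2)` of `SU(2)`, with `w u w⁻¹` the complex conjugate of `u`. -/
def conjElement : SU2 :=
  ⟨!![0, -1; 1, 0], by
    rw [Matrix.mem_specialUnitaryGroup_iff, Matrix.mem_unitaryGroup_iff]
    refine ⟨?_, by simp [Matrix.det_fin_two]⟩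
    ext i j
    fin_cases i <;> fin_cases j <;>
      simp [Matrix.mul_apply, Fin.sum_univ_two, Matrix.star_apply]⟩

/-- The contragredient of `u` in `SU(2)`, that is, its complex conjugate, written as the
conjugate of `u` by `conjElement`. -/
def twist (u : SU2) : SU2 := conjElement * u * conjElement⁻¹

theorem twist_conjElement : twist conjElement = conjElement := mul_inv_cancel_right _ _

theorem transpose_mul_coe_twist (u : SU2) : u.1.transpose * (twist u).1 = 1 := by
  have hdet : u.1 0 0 * u.1 1 1 - u.1 0 1 * u.1 1 0 = 1 := by
    rw [← Matrix.det_fin_two]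
    exact (Matrix.mem_specialUnitaryGroup_iff.1 u.2).2
  have htwist : (twist u).1 = !![0, -1; 1, 0] * u.1 * star !![0, -1; 1, 0] := rfl
  rw [htwist]
  ext i j
  fin_cases i <;> fin_cases j <;>
    simp [Matrix.mul_apply, Matrix.vecMul, dotProduct, Fin.sum_univ_two, Matrix.star_apply]
  · linear_combination hdet
  · ring
  · ring
  · linear_combination hdet

/-- The `3j` symbols as a matrix, whose columns are the (unnormalised) vectors
`∑ p q, threeJ a b c p q r • |p⟩ ⊗ |q⟩` of `H_a ⊗ H_b`. -/
def threeJMatrix : Matrix (Fin (a + 1) × Fin (b + 1)) (Fin (c + 1)) ℂ :=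
  Matrix.of fun pq r => (threeJ a b c pq.1 pq.2 r : ℂ)

theorem kronecker_mul_threeJMatrix_mul_transpose {u : Matrix (Fin 2) (Fin 2) ℂ} (hu : u.det = 1) :
    (spinMatrix a u ⊗ₖ spinMatrix b u) * threeJMatrix a b c * (spinMatrix c u).transpose =
      threeJMatrix a b c := by
  ext ⟨p', q'⟩ r'
  simp only [Matrix.mul_apply, Matrix.transpose_apply, Matrix.kronecker_apply, threeJMatrix,
    Matrix.of_apply, Fintype.sum_prod_type, Finset.sum_mul]
  rw [← sum_spinMatrix_mul_threeJ a b c hu p' q' r', Finset.sum_comm]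
  refine Finset.sum_congr rfl fun p _ => ?_
  rw [Finset.sum_comm]
  exact Finset.sum_congr rfl fun q _ => Finset.sum_congr rfl fun r _ => mul_right_comm _ _ _

theorem kronecker_mul_threeJMatrix (u : SU2) :
    (spinMatrix a u.1 ⊗ₖ spinMatrix b u.1) * threeJMatrix a b c =
      threeJMatrix a b c * spinMatrix c (twist u).1 := by
  have hdual : (spinMatrix c u.1).transpose * spinMatrix c (twist u).1 = 1 := by
    rw [← spinMatrix_transpose, ← spinMatrix_mul, transpose_mul_coe_twist, spinMatrix_one]
  conv_rhs => rw [← kronecker_mul_threeJMatrix_mul_transpose a b c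
    (Matrix.mem_specialUnitaryGroup_iff.1 u.2).2, Matrix.mul_assoc, hdual, Matrix.mul_one]

/-- The ladder basis `|j, m⟩`. -/
def ladder (n : ℕ) : OrthonormalBasis (Fin (n + 1)) ℂ (SpinSpace n) :=
  EuclideanSpace.basisFun _ ℂ

theorem spinRep_eq_toLin (n : ℕ) (u : SU2) :
    spinRep n u = Matrix.toLin (ladder n).toBasis (ladder n).toBasis (spinMatrix n u.1) := by
  rw [spinRep_apply, Matrix.toEuclideanLin_eq_toLin_orthonormal, ladder]

/-- The Clebsch-Gordan map from spin `c` to the tensor product of the spins `a` and `b`.  The `3j`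
symbols couple three spins to zero, so this map intertwines the dual of `spinRep c` with
`diagRep a b`. -/
def clebschGordan : SpinSpace c →ₗ[ℂ] SpinSpace a ⊗[ℂ] SpinSpace b :=
  Matrix.toLin (ladder c).toBasis ((ladder a).tensorProduct (ladder b)).toBasis
    (((√(c + 1) : ℝ) : ℂ) • threeJMatrix a b c)

theorem toMatrix_clebschGordan :
    LinearMap.toMatrix (ladder c).toBasis ((ladder a).tensorProduct (ladder b)).toBasis
      (clebschGordan a b c) = ((√(c + 1) : ℝ) : ℂ) • threeJMatrix a b c :=
  LinearMap.toMatrix_toLin _ _ _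

theorem diagRep_comp_clebschGordan (u : SU2) :
    diagRep a b u ∘ₗ clebschGordan a b c = clebschGordan a b c ∘ₗ spinRep c (twist u) := by
  apply (LinearMap.toMatrix (ladder c).toBasis
    ((ladder a).tensorProduct (ladder b)).toBasis).injective
  rw [LinearMap.toMatrix_comp _ ((ladder a).tensorProduct (ladder b)).toBasis,
    LinearMap.toMatrix_comp _ (ladder c).toBasis, toMatrix_clebschGordan, diagRep,
    Representation.tprod_apply, OrthonormalBasis.toBasis_tensorProduct, TensorProduct.toMatrix_map]
  simp only [spinRep_eq_toLin, LinearMap.toMatrix_toLin, Matrix.mul_smul, Matrix.smul_mul,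
    kronecker_mul_threeJMatrix]

/-- The equivariant Clebsch-Gordan map from spin `c` to the tensor product of the spins `a`
and `b`. -/
def coupling : SpinSpace c →ₗ[ℂ] SpinSpace a ⊗[ℂ] SpinSpace b :=
  clebschGordan a b c ∘ₗ spinRep c conjElement

theorem isIntertwiningMap_coupling :
    (spinRep c).IsIntertwiningMap (diagRep a b) (coupling a b c) := by
  refine isIntertwiningMap_iff_comp_eq.2 fun u => ?_
  have hconj : spinRep c conjElement ∘ₗ spinRep c u =
      spinRep c (twist u) ∘ₗ spinRep c conjElement := by
    simp only [← Module.End.mul_eq_comp, ← map_mul, twist, inv_mul_cancel_right]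
  rw [coupling, LinearMap.comp_assoc, hconj, ← LinearMap.comp_assoc, ← diagRep_comp_clebschGordan,
    LinearMap.comp_assoc]

theorem map_coupling_comp_coupling (a b c a' b' c' K : ℕ) :
    TensorProduct.map (coupling a b c) (coupling a' b' c') ∘ₗ coupling c c' K =
      (TensorProduct.map (clebschGordan a b c) (clebschGordan a' b' c') ∘ₗ
        clebschGordan c c' K) ∘ₗ spinRep K (conjElement * conjElement) := by
  have htwist := diagRep_comp_clebschGordan c c' K conjElement
  rw [twist_conjElement, diagRep, Representation.tprod_apply] at htwist
  rw [coupling, coupling, coupling, TensorProduct.map_comp, LinearMap.comp_assoc,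
    ← LinearMap.comp_assoc (spinRep K conjElement), htwist, map_mul]
  rfl

variable {a b c}

theorem toMatrix_adjoint_clebschGordan_comp_self_last (h : Triangle a b c) :
    (LinearMap.toMatrix (ladder c).toBasis (ladder c).toBasis
      (LinearMap.adjoint (clebschGordan a b c) ∘ₗ clebschGordan a b c)) (Fin.last c) (Fin.last c) =
      1 := by
  rw [LinearMap.toMatrix_comp _ ((ladder a).tensorProduct (ladder b)).toBasis,
    LinearMap.toMatrix_adjoint, toMatrix_clebschGordan, Matrix.mul_apply, Fintype.sum_prod_type]
  have hterm (p : Fin (a + 1)) (q : Fin (b + 1)) :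
      (((√(c + 1) : ℝ) : ℂ) • threeJMatrix a b c).conjTranspose (Fin.last c) (p, q) *
        (((√(c + 1) : ℝ) : ℂ) • threeJMatrix a b c) (p, q) (Fin.last c) =
      (((c + 1) * threeJ a b c p q (Fin.last c) ^ 2 : ℝ) : ℂ) := by
    simp only [Matrix.conjTranspose_apply, Matrix.smul_apply, threeJMatrix, Matrix.of_apply,
      smul_eq_mul, RCLike.star_def, Complex.conj_ofReal, ← Complex.ofReal_mul]
    rw [← sq, mul_pow, Real.sq_sqrt (by positivity)]
  simp_rw [hterm, ← Complex.ofReal_sum, ← Finset.mul_sum]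
  rw [sum_threeJ_last_sq h, mul_one_div_cancel (by positivity), Complex.ofReal_one]

theorem adjoint_coupling_comp_self (h : Triangle a b c) :
    LinearMap.adjoint (coupling a b c) ∘ₗ coupling a b c = LinearMap.id := by
  have hunitary := isUnitaryRep_spinRep
  obtain ⟨z, hz⟩ := isSchurFamily_spinRep.exists_eq_smul_id <| isIntertwiningMap_comp
    (isIntertwiningMap_adjoint (hunitary c) ((hunitary a).tprod (hunitary b))
      (isIntertwiningMap_coupling a b c)) (isIntertwiningMap_coupling a b c)
  have hcg : LinearMap.adjoint (clebschGordan a b c) ∘ₗ clebschGordan a b c =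
      z • LinearMap.id := by
    have hcoupling : clebschGordan a b c = coupling a b c ∘ₗ spinRep c conjElement⁻¹ := by
      rw [coupling, LinearMap.comp_assoc, ← Module.End.mul_eq_comp, ← map_mul, mul_inv_cancel,
        map_one, Module.End.one_eq_id, LinearMap.comp_id]
    rw [hcoupling, LinearMap.adjoint_comp, LinearMap.comp_assoc,
      ← LinearMap.comp_assoc _ (coupling a b c), hz, hunitary, LinearMap.smul_comp,
      LinearMap.id_comp, LinearMap.comp_smul, ← Module.End.mul_eq_comp, ← map_mul, inv_inv,
      mul_inv_cancel, map_one, Module.End.one_eq_id]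
  have hz_one : z = 1 := by
    rw [← toMatrix_adjoint_clebschGordan_comp_self_last h, hcg, map_smul,
      LinearMap.toMatrix_id, Matrix.smul_apply, Matrix.one_apply_eq, smul_eq_mul, mul_one]
  rw [hz, hz_one, one_smul]

theorem mem_coupled : c ∈ coupled a b ↔ Triangle a b c := by
  simp only [coupled, Finset.mem_filter, Finset.mem_range, and_iff_right_iff_imp]
  rintro ⟨-, -, -, h⟩
  omega

variable (a b)

theorem coupled_comm : coupled a b = coupled b a := by
  ext c
  simp only [mem_coupled, Triangle, add_comm b a]
  tauto

theorem coupled_self_add (a d : ℕ) :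
    coupled a (a + d) = (Finset.range (a + 1)).image fun i => d + 2 * i := by
  ext c
  simp only [mem_coupled, Triangle, Finset.mem_image, Finset.mem_range]
  constructor
  · rintro ⟨⟨S, hS⟩, h⟩
    exact ⟨S - (a + d), by omega, by omega⟩
  · rintro ⟨i, hi, rfl⟩
    exact ⟨⟨a + d + i, by ring⟩, by omega, by omega, by omega⟩

theorem sum_range_add_two_mul_add_one (d n : ℕ) :
    ∑ i ∈ Finset.range n, (d + 2 * i + 1) = n * (n + d) := by
  induction n with
  | zero => simp
  | succ n ih => rw [Finset.sum_range_succ, ih]; ring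

theorem sum_coupled_add_one : ∑ c ∈ coupled a b, (c + 1) = (a + 1) * (b + 1) := by
  wlog h : a ≤ b generalizing a b
  · rw [coupled_comm, this b a (by omega), mul_comm]
  obtain ⟨d, rfl⟩ := Nat.exists_eq_add_of_le h
  rw [coupled_self_add, Finset.sum_image (fun i _ j _ (hij : d + 2 * i = d + 2 * j) => by omega),
    sum_range_add_two_mul_add_one]
  ring

theorem isMultFreeDecomp_diagRep :
    IsMultFreeDecomp spinRep (diagRep a b) (coupled a b) (coupling a b) := by
  refine .of_finrank isSchurFamily_spinRep
    ((isUnitaryRep_spinRep a).tprod (isUnitaryRep_spinRep b)) (isIntertwiningMap_coupling a b)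
    (fun c hc => adjoint_coupling_comp_self (mem_coupled.1 hc)) ?_
  simp only [Module.finrank_tensorProduct, finrank_euclideanSpace_fin, sum_coupled_add_one]

variable {a b}

theorem twoSpinProj_eq (hc : c ∈ coupled a b) :
    twoSpinProj a b c = coupling a b c ∘ₗ LinearMap.adjoint (coupling a b c) :=
  (isMultFreeDecomp_diagRep a b).orthProj_isotypicPart hc

end ClebschGordan

/-! ### The copies of `H_{J₁} ⊗ H_{J₂}` in the four-fold space -/

theorem toMatrix_linearEquiv_comp {R U X Y ι κ μ : Type*} [CommSemiring R] [AddCommMonoid U]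
    [Module R U] [AddCommMonoid X] [Module R X] [AddCommMonoid Y] [Module R Y]
    [Finite ι] [Finite κ] [Fintype μ] [DecidableEq μ] (d : Module.Basis μ R U)
    {b : Module.Basis ι R X} {b' : Module.Basis κ R Y} {e : X ≃ₗ[R] Y} {f : ι ≃ κ}
    (he : e ∘ b = b' ∘ f) (A : U →ₗ[R] X) :
    LinearMap.toMatrix d b' (e.toLinearMap ∘ₗ A) =
      (LinearMap.toMatrix d b A).submatrix f.symm id := by
  have hb' : b' = (b.map e).reindex f := Module.Basis.eq_of_apply_eq fun k => by
    simpa using (congrFun he (f.symm k)).symm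
  ext k m
  simp [LinearMap.toMatrix_apply, hb']

section Interchange

variable {V V' W W' : Type*} [NormedAddCommGroup V] [InnerProductSpace ℂ V]
  [NormedAddCommGroup V'] [InnerProductSpace ℂ V']
  [NormedAddCommGroup W] [InnerProductSpace ℂ W]
  [NormedAddCommGroup W'] [InnerProductSpace ℂ W']
  {ι κ ι' κ' : Type*} [Fintype ι] [Fintype κ] [Fintype ι'] [Fintype κ']

theorem tensorTensorTensorComm_comp_tensorProduct (b : OrthonormalBasis ι ℂ V)
    (c : OrthonormalBasis κ ℂ W) (b' : OrthonormalBasis ι' ℂ V') (c' : OrthonormalBasis κ' ℂ W') :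
    TensorProduct.tensorTensorTensorComm ℂ V V' W W' ∘
        (b.tensorProduct b').tensorProduct (c.tensorProduct c') =
      (b.tensorProduct c).tensorProduct (b'.tensorProduct c') ∘
        Equiv.prodProdProdComm ι ι' κ κ' := by
  ext ⟨⟨i, i'⟩, j, j'⟩
  simp

variable [FiniteDimensional ℂ V] [FiniteDimensional ℂ V'] [FiniteDimensional ℂ W]
  [FiniteDimensional ℂ W']

variable (V V' W W') in
/-- The isometry `(V ⊗ V') ⊗ (W ⊗ W') ≃ (V ⊗ W) ⊗ (V' ⊗ W')` interchanging the two middle tensor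
factors. -/
def interchange : (V ⊗[ℂ] V') ⊗[ℂ] (W ⊗[ℂ] W') ≃ₗᵢ[ℂ] (V ⊗[ℂ] W) ⊗[ℂ] (V' ⊗[ℂ] W') :=
  let basis := ((stdOrthonormalBasis ℂ V).tensorProduct (stdOrthonormalBasis ℂ V')).tensorProduct
    ((stdOrthonormalBasis ℂ W).tensorProduct (stdOrthonormalBasis ℂ W'))
  have hbasis : Orthonormal ℂ (TensorProduct.tensorTensorTensorComm ℂ V V' W W' ∘ basis) := by
    rw [tensorTensorTensorComm_comp_tensorProduct]
    exact (OrthonormalBasis.orthonormal _).comp _ (Equiv.injective _)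
  LinearEquiv.isometryOfOrthonormal (v := basis.toBasis)
    (TensorProduct.tensorTensorTensorComm ℂ V V' W W')
    (by rw [OrthonormalBasis.coe_toBasis]; exact basis.orthonormal)
    (by rw [OrthonormalBasis.coe_toBasis]; exact hbasis)

theorem interchange_tmul (v : V) (v' : V') (w : W) (w' : W') :
    interchange V V' W W' ((v ⊗ₜ v') ⊗ₜ (w ⊗ₜ w')) = (v ⊗ₜ w) ⊗ₜ (v' ⊗ₜ w') :=
  TensorProduct.tensorTensorTensorComm_tmul ℂ v v' w w'

theorem isIntertwiningMap_interchange {G H : Type*} [Group G] [Group H]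
    (σ : Representation ℂ G V) (σ' : Representation ℂ G V')
    (τ : Representation ℂ H W) (τ' : Representation ℂ H W') :
    (outerTensor (σ.tprod σ') (τ.tprod τ')).IsIntertwiningMap
      ((outerTensor σ τ).tprod (outerTensor σ' τ'))
      (interchange V V' W W').toLinearEquiv.toLinearMap := by
  refine isIntertwiningMap_iff_comp_eq.2 fun g => TensorProduct.ext_fourfold' fun v v' w w' => ?_
  simp only [LinearMap.comp_apply, outerTensor, Representation.tprod_apply, TensorProduct.map_tmul,
    MonoidHom.comp_apply, LinearEquiv.coe_coe, LinearIsometryEquiv.coe_toLinearEquiv,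
    interchange_tmul, MonoidHom.coe_fst, MonoidHom.coe_snd]

variable {U : Type*} [AddCommGroup U] [Module ℂ U] {μ : Type*} [Fintype μ] [DecidableEq μ]

theorem toMatrix_interchange_comp (d : Module.Basis μ ℂ U) (b : OrthonormalBasis ι ℂ V)
    (c : OrthonormalBasis κ ℂ W) (b' : OrthonormalBasis ι' ℂ V') (c' : OrthonormalBasis κ' ℂ W')
    (A : U →ₗ[ℂ] (V ⊗[ℂ] V') ⊗[ℂ] (W ⊗[ℂ] W')) :
    LinearMap.toMatrix d ((b.tensorProduct c).tensorProduct (b'.tensorProduct c')).toBasis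
        ((interchange V V' W W').toLinearEquiv.toLinearMap ∘ₗ A) =
      (LinearMap.toMatrix d ((b.tensorProduct b').tensorProduct (c.tensorProduct c')).toBasis
        A).submatrix (Equiv.prodProdProdComm ι κ ι' κ') id := by
  have h := toMatrix_linearEquiv_comp (e := (interchange V V' W W').toLinearEquiv) d
    (b := ((b.tensorProduct b').tensorProduct (c.tensorProduct c')).toBasis)
    (b' := ((b.tensorProduct c).tensorProduct (b'.tensorProduct c')).toBasis)
    (f := Equiv.prodProdProdComm ι ι' κ κ') (A := A)
    (by
      rw [OrthonormalBasis.coe_toBasis, OrthonormalBasis.coe_toBasis]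
      exact tensorTensorTensorComm_comp_tensorProduct b c b' c')
  exact h

end Interchange

/-- The isometric embedding of `H_{J₁} ⊗ H_{J₂}` into the four-fold space. -/
def copyEmbedding (a b a' b' J₁ J₂ : ℕ) :
    SpinSpace J₁ ⊗[ℂ] SpinSpace J₂ →ₗ[ℂ] FourSpace a b a' b' :=
  (interchange (SpinSpace a) (SpinSpace a') (SpinSpace b) (SpinSpace b')).toLinearEquiv.toLinearMap
    ∘ₗ TensorProduct.map (coupling a a' J₁) (coupling b b' J₂)

theorem isUnitaryRep_pairRep (a b : ℕ) : IsUnitaryRep (pairRep a b) :=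
  (isUnitaryRep_spinRep a).outerTensor (isUnitaryRep_spinRep b)

/-- The adjoint of `copyEmbedding`. -/
def copyRestriction (a b a' b' J₁ J₂ : ℕ) :
    FourSpace a b a' b' →ₗ[ℂ] SpinSpace J₁ ⊗[ℂ] SpinSpace J₂ :=
  LinearMap.adjoint (𝕜 := ℂ) (E := SpinSpace J₁ ⊗[ℂ] SpinSpace J₂) (F := FourSpace a b a' b')
    (copyEmbedding a b a' b' J₁ J₂)

section FourSpace

variable (a b a' b' : ℕ)

theorem isMultFreeDecomp_fourRep :
    IsMultFreeDecomp (V := fun J : ℕ × ℕ => SpinSpace J.1 ⊗[ℂ] SpinSpace J.2)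
      (W := FourSpace a b a' b')
      (fun J => pairRep J.1 J.2) (fourRep a b a' b') (coupled a a' ×ˢ coupled b b')
      (fun J => copyEmbedding a b a' b' J.1 J.2) :=
  ((isMultFreeDecomp_diagRep a a').outerTensor (isMultFreeDecomp_diagRep b b')).comp_isometryEquiv
    ((isUnitaryRep_pairRep a b).tprod (isUnitaryRep_pairRep a' b')) _
    (isIntertwiningMap_interchange _ _ _ _)

theorem isIntertwiningMap_copyEmbedding (J₁ J₂ : ℕ) :
    (pairRep J₁ J₂).IsIntertwiningMap (fourRep a b a' b') (copyEmbedding a b a' b' J₁ J₂) := by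
  have h := (isMultFreeDecomp_fourRep a b a' b').isIntertwiningMap (J₁, J₂)
  exact h

theorem isIntertwiningMap_copyRestriction (J₁ J₂ : ℕ) :
    (fourRep a b a' b').IsIntertwiningMap (pairRep J₁ J₂) (copyRestriction a b a' b' J₁ J₂) := by
  have h := isIntertwiningMap_adjoint (W := FourSpace a b a' b') (isUnitaryRep_pairRep J₁ J₂)
    (isMultFreeDecomp_fourRep a b a' b').isUnitaryRep
    (isIntertwiningMap_copyEmbedding a b a' b' J₁ J₂)
  exact h

variable {a b a' b'} {J₁ J₂ : ℕ}

theorem copyRestriction_comp_copyEmbedding (hJ₁ : J₁ ∈ coupled a a') (hJ₂ : J₂ ∈ coupled b b') :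
    copyRestriction a b a' b' J₁ J₂ ∘ₗ copyEmbedding a b a' b' J₁ J₂ = LinearMap.id := by
  have h := (isMultFreeDecomp_fourRep a b a' b').adjoint_comp_self
    (Finset.mk_mem_product hJ₁ hJ₂)
  exact h

theorem copyProj_eq (hJ₁ : J₁ ∈ coupled a a') (hJ₂ : J₂ ∈ coupled b b') :
    copyProj a b a' b' J₁ J₂ =
      copyEmbedding a b a' b' J₁ J₂ ∘ₗ copyRestriction a b a' b' J₁ J₂ := by
  have h := (isMultFreeDecomp_fourRep a b a' b').orthProj_isotypicPart
    (Finset.mk_mem_product hJ₁ hJ₂)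
  exact h

theorem grandProj_eq (hJ₁ : J₁ ∈ coupled a a') (hJ₂ : J₂ ∈ coupled b b') (K : ℕ) :
    grandProj a b a' b' J₁ J₂ K =
      copyEmbedding a b a' b' J₁ J₂ ∘ₗ twoSpinProj J₁ J₂ K ∘ₗ copyRestriction a b a' b' J₁ J₂ := by
  have h := (isMultFreeDecomp_fourRep a b a' b').orthProj_iSup_map_intertwiningMap
    (Finset.mk_mem_product hJ₁ hJ₂) (isotypicPart (spinRep K) (diagRep J₁ J₂))
  rw [grandProj, twoSpinProj, range_orthProj]
  exact h

end FourSpace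

/-! ### Recoupling and the `9j` symbol -/

section Recoupling

section HilbertSpace

variable {U X W : Type*} [NormedAddCommGroup U] [InnerProductSpace ℂ U] [FiniteDimensional ℂ U]
  [NormedAddCommGroup X] [InnerProductSpace ℂ X] [FiniteDimensional ℂ X]
  [NormedAddCommGroup W] [InnerProductSpace ℂ W] [FiniteDimensional ℂ W]

theorem compression_comp_adjoint_self {Y ι : Type*} [NormedAddCommGroup Y] [InnerProductSpace ℂ Y]
    [FiniteDimensional ℂ Y] {E : X →ₗ[ℂ] W} {F : Y →ₗ[ℂ] W} {s : Finset ι} {c : ι → ℂ}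
    {P : ι → X →ₗ[ℂ] X} (h : (LinearMap.adjoint E ∘ₗ F) ∘ₗ LinearMap.adjoint
      (LinearMap.adjoint E ∘ₗ F) = ∑ i ∈ s, c i • P i) :
    (E ∘ₗ LinearMap.adjoint E) ∘ₗ (F ∘ₗ LinearMap.adjoint F) ∘ₗ E ∘ₗ LinearMap.adjoint E =
      ∑ i ∈ s, c i • (E ∘ₗ P i ∘ₗ LinearMap.adjoint E) := by
  have hsum : E ∘ₗ (∑ i ∈ s, c i • P i) ∘ₗ LinearMap.adjoint E =
      ∑ i ∈ s, c i • (E ∘ₗ P i ∘ₗ LinearMap.adjoint E) := by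
    simp only [linearMap_sum_comp, linearMap_comp_sum, LinearMap.smul_comp, LinearMap.comp_smul]
  rw [← hsum, ← h, LinearMap.adjoint_comp, LinearMap.adjoint_adjoint]
  simp only [LinearMap.comp_assoc]

theorem trace_adjoint_comp_of_eq_comp {Y : Type*} [AddCommMonoid Y] [Module ℂ Y]
    {E : X →ₗ[ℂ] W} {F : Y →ₗ[ℂ] W} {S : U →ₗ[ℂ] X} {T : U →ₗ[ℂ] Y}
    {A B : U →ₗ[ℂ] W} {u : U →ₗ[ℂ] U} (hA : E ∘ₗ S = A ∘ₗ u) (hB : F ∘ₗ T = B ∘ₗ u)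
    (hu : u ∘ₗ LinearMap.adjoint u = LinearMap.id) :
    LinearMap.trace ℂ U (LinearMap.adjoint S ∘ₗ (LinearMap.adjoint E ∘ₗ F) ∘ₗ T) =
      LinearMap.trace ℂ U (LinearMap.adjoint A ∘ₗ B) := by
  rw [LinearMap.comp_assoc, ← LinearMap.comp_assoc, ← LinearMap.adjoint_comp, hA, hB,
    LinearMap.adjoint_comp, LinearMap.comp_assoc, LinearMap.trace_comp_comm', LinearMap.comp_assoc,
    LinearMap.comp_assoc, hu, LinearMap.comp_id]

theorem trace_adjoint_comp {ι κ : Type*} [Fintype ι] [DecidableEq ι] [Fintype κ]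
    (d : OrthonormalBasis ι ℂ U) (b : OrthonormalBasis κ ℂ W) (A B : U →ₗ[ℂ] W) :
    LinearMap.trace ℂ U (LinearMap.adjoint A ∘ₗ B) =
      ((LinearMap.toMatrix d.toBasis b.toBasis A).conjTranspose *
        LinearMap.toMatrix d.toBasis b.toBasis B).trace := by
  classical rw [LinearMap.trace_eq_matrix_trace ℂ d.toBasis, LinearMap.toMatrix_comp _ b.toBasis,
    LinearMap.toMatrix_adjoint]

end HilbertSpace

open scoped Kronecker

variable (a b c a' b' c' K : ℕ)

/-- The vectors of spin `K` in the four-fold space obtained by coupling `a, b` to `c`, then `a', b'`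
to `c'`, and finally `c, c'` to `K`. -/
def couplingTree : SpinSpace K →ₗ[ℂ] FourSpace a b a' b' :=
  TensorProduct.map (clebschGordan a b c) (clebschGordan a' b' c') ∘ₗ clebschGordan c c' K

/-- The matrix of products of three `3j` symbols summed over the magnetic quantum numbers of the
two intermediate spins `c` and `c'`. -/
def threeJTree :
    Matrix ((Fin (a + 1) × Fin (b + 1)) × (Fin (a' + 1) × Fin (b' + 1))) (Fin (K + 1)) ℂ :=
  (threeJMatrix a b c ⊗ₖ threeJMatrix a' b' c') * threeJMatrix c c' K

theorem threeJTree_apply (p : Fin (a + 1)) (q : Fin (b + 1)) (p' : Fin (a' + 1))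
    (q' : Fin (b' + 1)) (r : Fin (K + 1)) :
    threeJTree a b c a' b' c' K ((p, q), (p', q')) r =
      ((∑ s, ∑ s', threeJ a b c p q s * threeJ a' b' c' p' q' s' * threeJ c c' K s s' r : ℝ) :
        ℂ) := by
  simp only [threeJTree, Matrix.mul_apply, Fintype.sum_prod_type, Matrix.kronecker_apply,
    threeJMatrix, Matrix.of_apply]
  push_cast
  rfl

theorem toMatrix_couplingTree :
    LinearMap.toMatrix (ladder K).toBasis
        (((ladder a).tensorProduct (ladder b)).tensorProduct
          ((ladder a').tensorProduct (ladder b'))).toBasis (couplingTree a b c a' b' c' K) =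
      ((√(c + 1) * √(c' + 1) * √(K + 1) : ℝ) : ℂ) • threeJTree a b c a' b' c' K := by
  rw [couplingTree, OrthonormalBasis.toBasis_tensorProduct,
    LinearMap.toMatrix_comp _ ((ladder c).tensorProduct (ladder c')).toBasis,
    toMatrix_clebschGordan, OrthonormalBasis.toBasis_tensorProduct (ladder c),
    TensorProduct.toMatrix_map, toMatrix_clebschGordan, toMatrix_clebschGordan,
    Matrix.smul_kronecker, Matrix.kronecker_smul, smul_smul, Matrix.smul_mul, Matrix.mul_smul,
    smul_smul, threeJTree]
  push_cast
  rfl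

theorem nineJ_eq_sum (k k' J₁ J₂ : ℕ) :
    nineJ a b k a' b' k' J₁ J₂ K =
      ∑ r, ∑ p, ∑ q, ∑ p', ∑ q',
        (∑ t, ∑ t', threeJ a a' J₁ p p' t * threeJ b b' J₂ q q' t' * threeJ J₁ J₂ K t t' r) *
          ∑ s, ∑ s', threeJ a b k p q s * threeJ a' b' k' p' q' s' * threeJ k k' K s s' r := by
  simp only [nineJ, Finset.sum_mul, Finset.mul_sum, ← Fintype.sum_prod_type']
  refine Fintype.sum_equiv
    { toFun := fun (p, q, s, p', q', s', t, t', r) => (r, p, q, p', q', (s, s'), t, t')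
      invFun := fun (r, p, q, p', q', (s, s'), t, t') => (p, q, s, p', q', s', t, t', r)
      left_inv := fun _ => rfl
      right_inv := fun _ => rfl } _ _ fun _ => ?_
  dsimp only [Equiv.coe_fn_mk]
  ring

theorem trace_conjTranspose_threeJTree_mul (k k' J₁ J₂ : ℕ) :
    (((threeJTree a a' J₁ b b' J₂ K).submatrix
      (Equiv.prodProdProdComm (Fin (a + 1)) (Fin (b + 1)) (Fin (a' + 1)) (Fin (b' + 1)))
        id).conjTranspose * threeJTree a b k a' b' k' K).trace =
      (nineJ a b k a' b' k' J₁ J₂ K : ℂ) := by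
  simp only [Matrix.trace, Matrix.diag_apply, Matrix.mul_apply, Matrix.conjTranspose_apply,
    Matrix.submatrix_apply, Fintype.sum_prod_type, Equiv.prodProdProdComm_apply, id,
    threeJTree_apply, Complex.star_def, Complex.conj_ofReal, nineJ_eq_sum]
  push_cast
  rfl

theorem trace_adjoint_interchange_comp_couplingTree (k k' J₁ J₂ : ℕ) :
    LinearMap.trace ℂ (SpinSpace K)
        (LinearMap.adjoint (𝕜 := ℂ) (E := SpinSpace K) (F := FourSpace a b a' b')
          ((interchange (SpinSpace a) (SpinSpace a') (SpinSpace b)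
            (SpinSpace b')).toLinearEquiv.toLinearMap ∘ₗ couplingTree a a' J₁ b b' J₂ K) ∘ₗ
          couplingTree a b k a' b' k' K) =
      ((√(J₁ + 1) * √(J₂ + 1) * √(k + 1) * √(k' + 1) * nineJ a b k a' b' k' J₁ J₂ K : ℝ) : ℂ) *
        (K + 1) := by
  have h := trace_adjoint_comp (W := FourSpace a b a' b') (ladder K)
    (((ladder a).tensorProduct (ladder b)).tensorProduct ((ladder a').tensorProduct (ladder b')))
    ((interchange (SpinSpace a) (SpinSpace a') (SpinSpace b)
      (SpinSpace b')).toLinearEquiv.toLinearMap ∘ₗ couplingTree a a' J₁ b b' J₂ K)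
    (couplingTree a b k a' b' k' K)
  have hI := toMatrix_interchange_comp (ladder K).toBasis (ladder a) (ladder b) (ladder a')
    (ladder b') (couplingTree a a' J₁ b b' J₂ K)
  have hsqrt : (√((K : ℝ) + 1) : ℂ) * √((K : ℝ) + 1) = K + 1 := by
    rw [← Complex.ofReal_mul, Real.mul_self_sqrt (by positivity)]
    push_cast
    rfl
  refine h.trans ?_
  rw [hI, toMatrix_couplingTree, toMatrix_couplingTree, Matrix.submatrix_smul,
    Pi.smul_apply, Pi.smul_apply, Matrix.conjTranspose_smul, Matrix.smul_mul, Matrix.mul_smul,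
    Matrix.trace_smul, Matrix.trace_smul, trace_conjTranspose_threeJTree_mul, ← hsqrt]
  simp only [Complex.star_def, Complex.conj_ofReal, smul_eq_mul]
  push_cast
  ring

/-- The recoupling operator from `H_k ⊗ H_{k'}` to `H_{J₁} ⊗ H_{J₂}`: its source is embedded into
the four-fold space by coupling `a, b` to `k` and `a', b'` to `k'`, its target by coupling `a, a'`
to `J₁` and `b, b'` to `J₂`. -/
def recoupling (a b k a' b' k' J₁ J₂ : ℕ) :
    SpinSpace k ⊗[ℂ] SpinSpace k' →ₗ[ℂ] SpinSpace J₁ ⊗[ℂ] SpinSpace J₂ :=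
  copyRestriction a b a' b' J₁ J₂ ∘ₗ TensorProduct.map (coupling a b k) (coupling a' b' k')

theorem isIntertwiningMap_recoupling (k k' J₁ J₂ : ℕ) :
    (diagRep k k').IsIntertwiningMap (diagRep J₁ J₂) (recoupling a b k a' b' k' J₁ J₂) := by
  have hdiag := isIntertwiningMap_restrict (isIntertwiningMap_copyRestriction a b a' b' J₁ J₂)
    ((MonoidHom.id SU2).prod (MonoidHom.id SU2))
  have hmap := isIntertwiningMap_tensorProduct_map (isIntertwiningMap_coupling a b k)
    (isIntertwiningMap_coupling a' b' k')
  have h := isIntertwiningMap_comp hdiag hmap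
  exact h

theorem recoupling_comp_coupling (k k' J₁ J₂ : ℕ) :
    recoupling a b k a' b' k' J₁ J₂ ∘ₗ coupling k k' K =
      ((√(J₁ + 1) * √(J₂ + 1) * √(k + 1) * √(k' + 1) * nineJ a b k a' b' k' J₁ J₂ K : ℝ) : ℂ) •
        coupling J₁ J₂ K := by
  have htrace := trace_adjoint_comp_of_eq_comp (X := SpinSpace J₁ ⊗[ℂ] SpinSpace J₂)
    (Y := SpinSpace k ⊗[ℂ] SpinSpace k') (W := FourSpace a b a' b')
    (E := copyEmbedding a b a' b' J₁ J₂)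
    (F := TensorProduct.map (coupling a b k) (coupling a' b' k'))
    (S := coupling J₁ J₂ K) (T := coupling k k' K)
    (A := (interchange (SpinSpace a) (SpinSpace a') (SpinSpace b)
      (SpinSpace b')).toLinearEquiv.toLinearMap ∘ₗ couplingTree a a' J₁ b b' J₂ K)
    (B := couplingTree a b k a' b' k' K) (u := spinRep K (conjElement * conjElement))
    (by rw [copyEmbedding, LinearMap.comp_assoc, map_coupling_comp_coupling, couplingTree]
        rfl)
    (map_coupling_comp_coupling a b k a' b' k' K)
    (by rw [isUnitaryRep_spinRep, ← Module.End.mul_eq_comp, ← map_mul, mul_inv_cancel, map_one,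
      Module.End.one_eq_id])
  refine (isMultFreeDecomp_diagRep J₁ J₂).eq_smul_of_trace_eq ?_ ?_
  · exact isIntertwiningMap_comp (isIntertwiningMap_recoupling a b a' b' k k' J₁ J₂)
      (isIntertwiningMap_coupling k k' K)
  · refine htrace.trans ?_
    rw [trace_adjoint_interchange_comp_couplingTree, finrank_euclideanSpace_fin, Nat.cast_succ]

end Recoupling

section Compression

variable (a b k a' b' k' J₁ J₂ : ℕ)

theorem recoupling_comp_adjoint_self :
    recoupling a b k a' b' k' J₁ J₂ ∘ₗ LinearMap.adjoint (recoupling a b k a' b' k' J₁ J₂) =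
      ∑ K ∈ coupled J₁ J₂, structConst a b k a' b' k' J₁ J₂ K • twoSpinProj J₁ J₂ K := by
  have hsum := (isMultFreeDecomp_diagRep J₁ J₂).comp_adjoint_self_eq_sum
    (isMultFreeDecomp_diagRep k k') fun K => recoupling_comp_coupling a b a' b' K k k' J₁ J₂
  refine hsum.trans (Finset.sum_congr rfl fun K hK => ?_)
  rw [← twoSpinProj_eq hK, structConst]
  simp only [mul_pow, Real.sq_sqrt (Nat.cast_add_one_pos _).le]

variable {a b k a' b' k' J₁ J₂}

theorem copyProj_comp_map_comp_copyProj (hk : k ∈ coupled a b) (hk' : k' ∈ coupled a' b')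
    (hJ₁ : J₁ ∈ coupled a a') (hJ₂ : J₂ ∈ coupled b b') :
    copyProj a b a' b' J₁ J₂ ∘ₗ TensorProduct.map (twoSpinProj a b k) (twoSpinProj a' b' k') ∘ₗ
        copyProj a b a' b' J₁ J₂ =
      ∑ K ∈ coupled J₁ J₂,
        structConst a b k a' b' k' J₁ J₂ K • grandProj a b a' b' J₁ J₂ K := by
  have hF : TensorProduct.map (twoSpinProj a b k) (twoSpinProj a' b' k') =
      TensorProduct.map (coupling a b k) (coupling a' b' k') ∘ₗ
        LinearMap.adjoint (𝕜 := ℂ) (E := SpinSpace k ⊗[ℂ] SpinSpace k') (F := FourSpace a b a' b')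
          (TensorProduct.map (coupling a b k) (coupling a' b' k')) := by
    rw [twoSpinProj_eq hk, twoSpinProj_eq hk', TensorProduct.map_comp, TensorProduct.adjoint_map]
  have hcompression := compression_comp_adjoint_self (X := SpinSpace J₁ ⊗[ℂ] SpinSpace J₂)
    (Y := SpinSpace k ⊗[ℂ] SpinSpace k') (W := FourSpace a b a' b')
    (recoupling_comp_adjoint_self a b k a' b' k' J₁ J₂)
  rw [hF, copyProj_eq hJ₁ hJ₂]
  refine hcompression.trans (Finset.sum_congr rfl fun K _ => ?_)
  rw [grandProj_eq hJ₁ hJ₂]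
  rfl

end Compression

/-! ### Traces -/

theorem trace_comp_comp_comp_of_comp_eq {R V W : Type*} [CommRing R] [AddCommGroup V] [Module R V]
    [Module.Free R V] [Module.Finite R V] [AddCommGroup W] [Module R W] [Module.Free R W]
    [Module.Finite R W] {E : V →ₗ[R] W} {F : W →ₗ[R] V} {A : V →ₗ[R] V} {B : W →ₗ[R] W}
    (hFE : F ∘ₗ E = LinearMap.id) (hE : E ∘ₗ A = B ∘ₗ E) (P : V →ₗ[R] V) :
    LinearMap.trace R W ((E ∘ₗ P ∘ₗ F) ∘ₗ B) = LinearMap.trace R V (P ∘ₗ A) := by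
  rw [LinearMap.comp_assoc, LinearMap.trace_comp_comm', LinearMap.comp_assoc, LinearMap.comp_assoc,
    ← hE, ← LinearMap.comp_assoc A, hFE, LinearMap.id_comp]

section Trace

variable {a b a' b' : ℕ}

theorem trace_comp_fourRep (A : FourSpace a b a' b' →ₗ[ℂ] FourSpace a b a' b') (g : SU2 × SU2) :
    LinearMap.trace ℂ _ (A ∘ₗ fourRep a b a' b' g) =
      LinearMap.trace ℂ _ (blockDiagPart a b a' b' A ∘ₗ fourRep a b a' b' g) := by
  have h := (isMultFreeDecomp_fourRep a b a' b').trace_comp_eq_trace_blockDiag A g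
  rw [Finset.sum_product] at h
  exact h

theorem trace_grandProj_comp_fourRep {J₁ J₂ : ℕ} (hJ₁ : J₁ ∈ coupled a a')
    (hJ₂ : J₂ ∈ coupled b b') (K : ℕ) (u v : SU2) :
    LinearMap.trace ℂ _ (grandProj a b a' b' J₁ J₂ K ∘ₗ fourRep a b a' b' (u, v)) =
      quasichar J₁ J₂ K u v := by
  rw [grandProj_eq hJ₁ hJ₂]
  exact trace_comp_comp_comp_of_comp_eq (copyRestriction_comp_copyEmbedding hJ₁ hJ₂)
    (isIntertwiningMap_iff_comp_eq.1 (isIntertwiningMap_copyEmbedding a b a' b' J₁ J₂) (u, v)) _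

theorem trace_map_comp_fourRep (k k' : ℕ) (u v : SU2) :
    LinearMap.trace ℂ _ (TensorProduct.map (twoSpinProj a b k) (twoSpinProj a' b' k') ∘ₗ
        fourRep a b a' b' (u, v)) =
      quasichar a b k u v * quasichar a' b' k' u v := by
  rw [fourRep, Representation.tprod_apply, ← TensorProduct.map_comp,
    LinearMap.trace_tensorProduct', quasichar, quasichar]

end Trace

end SpinRecoupling

end

open SpinRecoupling in
theorem mainTheorem1 (j₁ j₂ k j₁' j₂' k' : ℕ)
    (hk : k ∈ coupled j₁ j₂) (hk' : k' ∈ coupled j₁' j₂') :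
    blockDiagPart j₁ j₂ j₁' j₂'
        (TensorProduct.map (twoSpinProj j₁ j₂ k) (twoSpinProj j₁' j₂' k')) =
      ∑ J₁ ∈ coupled j₁ j₁', ∑ J₂ ∈ coupled j₂ j₂', ∑ K ∈ coupled J₁ J₂,
        structConst j₁ j₂ k j₁' j₂' k' J₁ J₂ K • grandProj j₁ j₂ j₁' j₂' J₁ J₂ K ∧
    (∀ u v : SU2,
      LinearMap.trace ℂ _
          (TensorProduct.map (twoSpinProj j₁ j₂ k) (twoSpinProj j₁' j₂' k') ∘ₗ
            fourRep j₁ j₂ j₁' j₂' (u, v)) =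
        ∑ J₁ ∈ coupled j₁ j₁', ∑ J₂ ∈ coupled j₂ j₂', ∑ K ∈ coupled J₁ J₂,
          structConst j₁ j₂ k j₁' j₂' k' J₁ J₂ K *
            LinearMap.trace ℂ _
              (grandProj j₁ j₂ j₁' j₂' J₁ J₂ K ∘ₗ fourRep j₁ j₂ j₁' j₂' (u, v))) ∧
    (∀ u v : SU2,
      quasichar j₁ j₂ k u v * quasichar j₁' j₂' k' u v =
        ∑ J₁ ∈ coupled j₁ j₁', ∑ J₂ ∈ coupled j₂ j₂', ∑ K ∈ coupled J₁ J₂,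
          structConst j₁ j₂ k j₁' j₂' k' J₁ J₂ K * quasichar J₁ J₂ K u v) := by
  have hblock := Finset.sum_congr rfl fun J₁ (hJ₁ : J₁ ∈ coupled j₁ j₁') =>
    Finset.sum_congr rfl fun J₂ (hJ₂ : J₂ ∈ coupled j₂ j₂') =>
      copyProj_comp_map_comp_copyProj hk hk' hJ₁ hJ₂
  have htrace (u v : SU2) : LinearMap.trace ℂ _
      (TensorProduct.map (twoSpinProj j₁ j₂ k) (twoSpinProj j₁' j₂' k') ∘ₗ
        fourRep j₁ j₂ j₁' j₂' (u, v)) =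
      ∑ J₁ ∈ coupled j₁ j₁', ∑ J₂ ∈ coupled j₂ j₂', ∑ K ∈ coupled J₁ J₂,
        structConst j₁ j₂ k j₁' j₂' k' J₁ J₂ K *
          LinearMap.trace ℂ _
            (grandProj j₁ j₂ j₁' j₂' J₁ J₂ K ∘ₗ fourRep j₁ j₂ j₁' j₂' (u, v)) := by
    rw [trace_comp_fourRep, blockDiagPart, hblock]
    simp only [linearMap_sum_comp, LinearMap.smul_comp, map_sum, map_smul, smul_eq_mul]
  refine ⟨hblock, htrace, fun u v => ?_⟩
  rw [← trace_map_comp_fourRep, htrace]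
  refine Finset.sum_congr rfl fun J₁ hJ₁ => Finset.sum_congr rfl fun J₂ hJ₂ =>
    Finset.sum_congr rfl fun K _ => ?_
  rw [trace_grandProj_comp_fourRep hJ₁ hJ₂]
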